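/- Let $\Gamma \subset \mathrm{SL}(3,\mathbb{R})$ be a discrete subgroup that is Zariski-dense in $\mathrm{SL}(3,\mathbb{R})$. Let $\iota:\mathbb{R}^2\hookrightarrow\mathbb{R}^3$ be an injective linear map, let $W\subset\mathbb{R}^3$ be a linear complement of $\iota(\mathbb{R}^2)$, and let $\phi:\mathrm{SL}(2,\mathbb{R})\to\mathrm{SL}(3,\mathbb{R})$ be the induced (reducible) embedding: $\phi(A)\,\iota(v)=\iota(Av)$ for $v\in\mathbb{R}^2$, and $\phi(A)w=w$ for $w\in W$. Suppose that $\Delta=\phi^{-1}(\Gamma)\cong\Gamma\cap\phi(\mathrm{SL}(2,\mathbb{R}))$ is a lattice in $\mathrm{SL}(2,\mathbb{R})$, i.e. $\Delta$ is discrete and $\mathrm{SL}(2,\mathbb{R})/\Delta$ carries a nonzero finite $\mathrm{SL}(2,\mathbb{R})$-invariant Borel measure. Then $\Gamma$ acts minimally on the manifold $\mathrm{Flag}(\mathbb{R}^3)$ of complete flags $\{0\}\subset V_1\subset V_2\subset\mathbb{R}^3$; that is, every $\Gamma$-orbit in $\mathrm{Flag}(\mathbb{R}^3)$ is dense. -/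

import Mathlib

open scoped MatrixGroups

/-- Zariski density in `SL(3, ℝ)`: every polynomial in the nine matrix entries that vanishes on
the set `S` vanishes on all of `SL(3, ℝ)`. -/
def IsZariskiDense (S : Set SL(3, ℝ)) : Prop :=
  ∀ f : MvPolynomial (Fin 3 × Fin 3) ℝ,
    (∀ g ∈ S, MvPolynomial.eval (fun ij => (g : Matrix (Fin 3) (Fin 3) ℝ) ij.1 ij.2) f = 0) →
      ∀ g : SL(3, ℝ),
        MvPolynomial.eval (fun ij => (g : Matrix (Fin 3) (Fin 3) ℝ) ij.1 ij.2) f = 0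

/-- A lattice in `SL(2, ℝ)`: a discrete subgroup `Δ` such that the homogeneous space
`SL(2, ℝ) / Δ` carries a nonzero finite Borel measure invariant under left translations. -/
structure IsLatticeSL2 (Δ : Subgroup SL(2, ℝ)) : Prop where
  discrete : DiscreteTopology Δ
  exists_measure : letI : MeasurableSpace (SL(2, ℝ) ⧸ Δ) := borel _
    ∃ μ : MeasureTheory.Measure (SL(2, ℝ) ⧸ Δ), μ ≠ 0 ∧ MeasureTheory.IsFiniteMeasure μ ∧
      MeasureTheory.SMulInvariantMeasure SL(2, ℝ) (SL(2, ℝ) ⧸ Δ) μ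

section ReducibleEmbedding

/-- The isomorphism `ℝ² × W ≃ ℝ³`, `(v, w) ↦ ι v + w`, attached to an injective linear map
`ι : ℝ² → ℝ³` and a complement `W` of its image. -/
noncomputable def splittingEquiv (ι : (Fin 2 → ℝ) →ₗ[ℝ] (Fin 3 → ℝ))
    (hι : Function.Injective ι) (W : Submodule ℝ (Fin 3 → ℝ))
    (hW : IsCompl (LinearMap.range ι) W) : ((Fin 2 → ℝ) × W) ≃ₗ[ℝ] (Fin 3 → ℝ) :=
  ((LinearEquiv.ofInjective ι hι).prodCongr (LinearEquiv.refl ℝ W)).trans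
    (Submodule.prodEquivOfIsCompl _ _ hW)

/-- The endomorphism of `ℝ³ = ι(ℝ²) ⊕ W` that acts on `ι(ℝ²)` as `A` does on `ℝ²`, and trivially
on `W`. -/
noncomputable def splittingMap (ι : (Fin 2 → ℝ) →ₗ[ℝ] (Fin 3 → ℝ))
    (hι : Function.Injective ι) (W : Submodule ℝ (Fin 3 → ℝ))
    (hW : IsCompl (LinearMap.range ι) W) (A : Matrix (Fin 2) (Fin 2) ℝ) :
    (Fin 3 → ℝ) →ₗ[ℝ] (Fin 3 → ℝ) :=
  (splittingEquiv ι hι W hW).conj ((Matrix.toLin' A).prodMap LinearMap.id)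

theorem splittingMap_range (ι : (Fin 2 → ℝ) →ₗ[ℝ] (Fin 3 → ℝ))
    (hι : Function.Injective ι) (W : Submodule ℝ (Fin 3 → ℝ))
    (hW : IsCompl (LinearMap.range ι) W) (A : Matrix (Fin 2) (Fin 2) ℝ) (v : Fin 2 → ℝ) :
    splittingMap ι hι W hW A (ι v) = ι (A.mulVec v) := by
  have h : (splittingEquiv ι hι W hW).symm (ι v) = (v, 0) := by
    rw [LinearEquiv.symm_apply_eq]
    simp [splittingEquiv]
  rw [splittingMap, LinearEquiv.conj_apply_apply, h, LinearMap.prodMap_apply,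
    Matrix.toLin'_apply]
  simp only [splittingEquiv, LinearEquiv.trans_apply, LinearEquiv.prodCongr_apply,
    Submodule.coe_prodEquivOfIsCompl', LinearEquiv.ofInjective_apply, map_zero,
    ZeroMemClass.coe_zero, add_zero]

theorem splittingMap_compl (ι : (Fin 2 → ℝ) →ₗ[ℝ] (Fin 3 → ℝ))
    (hι : Function.Injective ι) (W : Submodule ℝ (Fin 3 → ℝ))
    (hW : IsCompl (LinearMap.range ι) W) (A : Matrix (Fin 2) (Fin 2) ℝ) (w : Fin 3 → ℝ)
    (hw : w ∈ W) : splittingMap ι hι W hW A w = w := by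
  have h : (splittingEquiv ι hι W hW).symm w = (0, ⟨w, hw⟩) := by
    rw [LinearEquiv.symm_apply_eq]
    simp [splittingEquiv]
  rw [splittingMap, LinearEquiv.conj_apply_apply, h, LinearMap.prodMap_apply]
  simp [splittingEquiv]

theorem det_splittingMap (ι : (Fin 2 → ℝ) →ₗ[ℝ] (Fin 3 → ℝ))
    (hι : Function.Injective ι) (W : Submodule ℝ (Fin 3 → ℝ))
    (hW : IsCompl (LinearMap.range ι) W) (A : Matrix (Fin 2) (Fin 2) ℝ) :
    LinearMap.det (splittingMap ι hι W hW A) = A.det := by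
  rw [splittingMap, LinearEquiv.conj_apply, LinearMap.comp_assoc,
    LinearMap.det_conj, LinearMap.det_prodMap, LinearMap.det_toLin', LinearMap.det_id, mul_one]

theorem splittingMap_one (ι : (Fin 2 → ℝ) →ₗ[ℝ] (Fin 3 → ℝ))
    (hι : Function.Injective ι) (W : Submodule ℝ (Fin 3 → ℝ))
    (hW : IsCompl (LinearMap.range ι) W) : splittingMap ι hι W hW 1 = LinearMap.id := by
  rw [splittingMap, Matrix.toLin'_one, LinearMap.prodMap_id, LinearEquiv.conj_id]

theorem splittingMap_mul (ι : (Fin 2 → ℝ) →ₗ[ℝ] (Fin 3 → ℝ))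
    (hι : Function.Injective ι) (W : Submodule ℝ (Fin 3 → ℝ))
    (hW : IsCompl (LinearMap.range ι) W) (A B : Matrix (Fin 2) (Fin 2) ℝ) :
    splittingMap ι hι W hW (A * B) = splittingMap ι hι W hW A ∘ₗ splittingMap ι hι W hW B := by
  rw [splittingMap, splittingMap, splittingMap, ← LinearEquiv.conj_comp, Matrix.toLin'_mul,
    LinearMap.prodMap_comp, LinearMap.id_comp]

/-- The reducible embedding `SL(2, ℝ) → SL(3, ℝ)` induced by an inclusion `ι : ℝ² → ℝ³` and a
complement `W` of its image: `A` acts on the image of `ι` as it does on `ℝ²`, and trivially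
on `W`. -/
noncomputable def reducibleEmbedding (ι : (Fin 2 → ℝ) →ₗ[ℝ] (Fin 3 → ℝ))
    (hι : Function.Injective ι) (W : Submodule ℝ (Fin 3 → ℝ))
    (hW : IsCompl (LinearMap.range ι) W) : SL(2, ℝ) →* SL(3, ℝ) where
  toFun A := ⟨LinearMap.toMatrix' (splittingMap ι hι W hW A.1), by
    rw [LinearMap.det_toMatrix', det_splittingMap, A.2]⟩
  map_one' := by
    apply Subtype.ext
    change LinearMap.toMatrix' (splittingMap ι hι W hW 1) = 1
    rw [splittingMap_one, LinearMap.toMatrix'_id]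
  map_mul' A B := by
    apply Subtype.ext
    change LinearMap.toMatrix' (splittingMap ι hι W hW (A.1 * B.1)) =
      LinearMap.toMatrix' (splittingMap ι hι W hW A.1) *
        LinearMap.toMatrix' (splittingMap ι hι W hW B.1)
    rw [splittingMap_mul, LinearMap.toMatrix'_comp]

end ReducibleEmbedding

/-- A complete flag `0 ⊂ V₁ ⊂ V₂ ⊂ ℝ³`. -/
@[ext]
structure Flag3 where
  V₁ : Submodule ℝ (Fin 3 → ℝ)
  V₂ : Submodule ℝ (Fin 3 → ℝ)
  finrank_V₁ : Module.finrank ℝ V₁ = 1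
  finrank_V₂ : Module.finrank ℝ V₂ = 2
  le : V₁ ≤ V₂

namespace Flag3

/-- The natural action of `SL(3, ℝ)` on complete flags: `g • (V₁, V₂) = (g V₁, g V₂)`. -/
noncomputable instance : MulAction SL(3, ℝ) Flag3 where
  smul g F :=
    { V₁ := F.V₁.map (Matrix.SpecialLinearGroup.toLin' g).toLinearMap
      V₂ := F.V₂.map (Matrix.SpecialLinearGroup.toLin' g).toLinearMap
      finrank_V₁ := by rw [LinearEquiv.finrank_map_eq, F.finrank_V₁]
      finrank_V₂ := by rw [LinearEquiv.finrank_map_eq, F.finrank_V₂]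
      le := Submodule.map_mono F.le }
  one_smul F := by
    refine Flag3.ext ?_ ?_
    · change F.V₁.map (Matrix.SpecialLinearGroup.toLin' (1 : SL(3, ℝ))).toLinearMap = F.V₁
      rw [map_one]
      exact Submodule.map_id _
    · change F.V₂.map (Matrix.SpecialLinearGroup.toLin' (1 : SL(3, ℝ))).toLinearMap = F.V₂
      rw [map_one]
      exact Submodule.map_id _
  mul_smul g h F := by
    refine Flag3.ext ?_ ?_
    · change F.V₁.map (Matrix.SpecialLinearGroup.toLin' (g * h)).toLinearMap =
        (F.V₁.map (Matrix.SpecialLinearGroup.toLin' h).toLinearMap).map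
          (Matrix.SpecialLinearGroup.toLin' g).toLinearMap
      rw [map_mul, ← Submodule.map_comp]
      rfl
    · change F.V₂.map (Matrix.SpecialLinearGroup.toLin' (g * h)).toLinearMap =
        (F.V₂.map (Matrix.SpecialLinearGroup.toLin' h).toLinearMap).map
          (Matrix.SpecialLinearGroup.toLin' g).toLinearMap
      rw [map_mul, ← Submodule.map_comp]
      rfl

/-- Ordered pairs of linearly independent vectors in `ℝ³`, with the subspace topology. -/
abbrev Frame : Type := {v : Fin 2 → Fin 3 → ℝ // LinearIndependent ℝ v}

/-- The flag `span {v₀} ⊂ span {v₀, v₁}` of a pair `(v₀, v₁)` of independent vectors. -/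
noncomputable def ofFrame (v : Frame) : Flag3 where
  V₁ := Submodule.span ℝ {v.1 0}
  V₂ := Submodule.span ℝ (Set.range v.1)
  finrank_V₁ := finrank_span_singleton (v.2.ne_zero 0)
  finrank_V₂ := by rw [finrank_span_eq_card v.2, Fintype.card_fin]
  le := Submodule.span_mono (Set.singleton_subset_iff.2 (Set.mem_range_self 0))

/-- The usual topology of the flag manifold `Flag(ℝ³) = SL(3, ℝ) / P`, as the quotient topology
for the surjection that sends a pair of independent vectors to the flag it spans. -/
noncomputable instance : TopologicalSpace Flag3 := TopologicalSpace.coinduced ofFrame inferInstance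

end Flag3

/-! Conjugating Γ puts φ in block form: ι(ℝ²) becomes the horizontal plane U and W the axis ℝe₃. The
claim is then that a nonempty closed Γ-invariant set of flags is everything. A flag is recorded by a
vector x and a functional f with x ⬝ᵥ f = 0, on which Γ acts linearly.

The lattice Δ enters in two ways. Poincaré recurrence for diagonal elements yields δₙ ∈ Δ and
scalars cₙ → 0 with cₙδₙ tending to any prescribed rank-one projection
(`exists_tendsto_projection`). The Mautner phenomenon makes Δ topologically transitive on ℝ², so
Baire's theorem gives vectors with dense orbit, and rescaling places one on any affine line missing
0 (`exists_dense_orbit`).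

By Zariski density some flag of the set is in general position. Rank-one limits push it to every
flag whose line L lies in U and whose plane is L + ℝe₃ (`horizontal`). A translate of this circle by
g ∈ Γ consists of the planes through ge₃, each with its intersection with gU. Applying δₙ so that
ge₃ tends to e₁ and gU to span(e₁, e₃) produces in the limit all flags with line ℝe₁ (`base_line`).

The set of lines all of whose flags occur is closed and Γ-invariant. It contains ℝe₁, hence every
line of U by rank-one limits, hence every line of gU. For suitable g the plane gU meets height one
in an affine line missing the axis. A vector there with dense Δ-orbit reaches all of height one, and
closedness gives all lines (`IsInvariantFlagSet.eq_univ`). -/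

open scoped MatrixGroups
open MeasureTheory Filter Topology Set

/-! ### Overlaps of open sets under a finite invariant measure. -/

section InvariantMeasure

variable {G X : Type*} [Group G] [TopologicalSpace G] [TopologicalSpace X] [MulAction G X]
  [ContinuousSMul G X] [MeasurableSpace X] [BorelSpace X]
  {μ : Measure X}

/-- An invariant nonzero measure on a homogeneous space charges every nonempty open set. -/
theorem measure_ne_zero_of_isOpen [TopologicalSpace.SeparableSpace G]
    [MulAction.IsPretransitive G X] [SMulInvariantMeasure G X μ]
    [IsTopologicalGroup G] (hμ : μ ≠ 0) {O : Set X} (hO : IsOpen O) (hne : O.Nonempty) :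
    μ O ≠ 0 := by
  intro h0
  apply hμ
  rw [← Measure.measure_univ_eq_zero]
  obtain ⟨x, hx⟩ := hne
  obtain ⟨D, hDc, hD⟩ := TopologicalSpace.exists_countable_dense G
  -- For each y the group elements moving y into O form a nonempty open set, which meets D; so
  -- countably many translates of O cover X.
  have hcov : (univ : Set X) ⊆ ⋃ d ∈ D, (fun y : X => d • y) ⁻¹' O := by
    intro y _
    obtain ⟨g, hg⟩ := MulAction.exists_smul_eq G y x
    have hopen : IsOpen {d : G | d • y ∈ O} := hO.preimage (continuous_id.smul continuous_const)
    obtain ⟨d, hd, hdD⟩ := hD.inter_open_nonempty _ hopen ⟨g, by simpa [hg] using hx⟩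
    exact mem_biUnion hdD hd
  refine measure_mono_null hcov ((measure_biUnion_null_iff hDc).2 fun d _ => ?_)
  exact (measure_preimage_smul μ d O).trans h0

/-- If `h i → a` and `a` moves `Q` into the open set `V`, then most of `Q` is moved into `V`
by `h i`. -/
theorem tendsto_measure_inter_preimage_compl [IsFiniteMeasure μ] {Q V : Set X}
    (hQ : MeasurableSet Q) (hV : IsOpen V) {h : ℕ → G} {a : G} (ha : Tendsto h atTop (𝓝 a))
    (hQV : ∀ x ∈ Q, a • x ∈ V) :
    Tendsto (fun n => μ (Q ∩ {x | h n • x ∉ V})) atTop (𝓝 0) := by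
  have hm : ∀ n, MeasurableSet (Q ∩ {x | h n • x ∉ V}) := fun n =>
    hQ.inter (hV.preimage (continuous_const_smul (h n))).measurableSet.compl
  have := tendsto_measure_of_tendsto_indicator_of_isFiniteMeasure (μ := μ) (A := (∅ : Set X))
    atTop hm (fun x => ?_)
  · simpa using this
  · by_cases hx : x ∈ Q
    · have h1 : ∀ᶠ n in atTop, h n • x ∈ V :=
        (ha.smul_const x).eventually (hV.mem_nhds (hQV x hx))
      filter_upwards [h1] with n hn
      simp [hn]
    · exact Eventually.of_forall fun n => by simp [hx]

/-- If the open sets `U` and `V` overlap less and less under `h i → a`, then `a` moves `U` off `V`,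
provided nonempty open sets are not null. -/
theorem smul_notMem_of_tendsto [IsFiniteMeasure μ]
    (hpos : ∀ O : Set X, IsOpen O → O.Nonempty → μ O ≠ 0) {U V : Set X} (hU : IsOpen U)
    (hV : IsOpen V) {h : ℕ → G} {a : G} (ha : Tendsto h atTop (𝓝 a))
    (h0 : Tendsto (fun n => μ (U ∩ {x | h n • x ∈ V})) atTop (𝓝 0)) :
    ∀ x ∈ U, a • x ∉ V := by
  intro x hx hxV
  -- Each point of this open set is either not yet moved into V by h n or lies in the overlap. Both
  -- parts have measure tending to 0.
  have hQ : IsOpen (U ∩ {x | a • x ∈ V}) := hU.inter (hV.preimage (continuous_const_smul a))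
  refine hpos _ hQ ⟨x, hx, hxV⟩ ?_
  have h1 := tendsto_measure_inter_preimage_compl (μ := μ) hQ.measurableSet hV ha
    (fun x hx => hx.2)
  have h2 := h1.add h0
  rw [add_zero] at h2
  refine le_antisymm (ge_of_tendsto' h2 fun n => ?_) bot_le
  refine (measure_mono ?_).trans (measure_union_le _ _)
  intro y hy
  by_cases hn : h n • y ∈ V
  · exact Or.inr ⟨hy.1, hn⟩
  · exact Or.inl ⟨hy, hn⟩

/-- Near the identity, a set disjoint from the open set `U` has small overlap with the translates
of `U`. -/
theorem tendsto_measure_inter_preimage_of_disjoint [IsFiniteMeasure μ] {U V : Set X}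
    (hU : IsOpen U) (hUV : Disjoint U V) {h : ℕ → G} (ha : Tendsto h atTop (𝓝 1)) :
    Tendsto (fun n => μ (U ∩ {x | h n • x ∈ V})) atTop (𝓝 0) := by
  have h1 := tendsto_measure_inter_preimage_compl (μ := μ) hU.measurableSet hU ha
    (fun x hx => by simpa using hx)
  refine tendsto_of_tendsto_of_tendsto_of_le_of_le tendsto_const_nhds h1 (fun _ => bot_le)
    (fun n => measure_mono ?_)
  rintro y ⟨hy, hyV⟩
  exact ⟨hy, fun h' => disjoint_left.1 hUV h' hyV⟩

/-- The overlap of `U` with translates of `V` is bi-invariant under a set of elements stabilizing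
`U` and `V`. -/
theorem measure_inter_preimage_mul_mul [SMulInvariantMeasure G X μ] {U V : Set X} {n n' : G}
    (hU : ∀ x, n' • x ∈ U ↔ x ∈ U) (hV : ∀ x, n • x ∈ V ↔ x ∈ V) (g : G) :
    μ (U ∩ {x | (n * g * n') • x ∈ V}) = μ (U ∩ {x | g • x ∈ V}) := by
  rw [← measure_preimage_smul μ n' (U ∩ {x | g • x ∈ V})]
  congr 1
  ext x
  simp [mul_smul, hU, hV]

/-- Recurrence for open sets. -/
theorem frequently_exists_pow_smul_mem [IsFiniteMeasure μ] [SMulInvariantMeasure G X μ]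
    (a : G) {O : Set X} (hO : IsOpen O) (h0 : μ O ≠ 0) :
    ∃ᶠ m in atTop, ∃ x ∈ O, a ^ m • x ∈ O := by
  have h1 := (measurePreserving_smul a μ).conservative.frequently_measure_inter_ne_zero
    hO.measurableSet.nullMeasurableSet h0
  refine h1.mono fun m hm => ?_
  obtain ⟨x, hx, hx'⟩ := nonempty_of_measure_ne_zero hm
  refine ⟨x, hx, ?_⟩
  rwa [smul_iterate, mem_preimage] at hx'

end InvariantMeasure

/-! ### Unipotent and diagonal elements of SL(2, ℝ), and the Mautner phenomenon. -/

namespace SL2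

/-- Upper unipotent elements of `SL(2, ℝ)`. -/
def upper (x : ℝ) : SL(2, ℝ) := ⟨!![1, x; 0, 1], by simp [Matrix.det_fin_two]⟩

/-- Lower unipotent elements of `SL(2, ℝ)`. -/
def lower (x : ℝ) : SL(2, ℝ) := ⟨!![1, 0; x, 1], by simp [Matrix.det_fin_two]⟩

/-- Diagonal elements of `SL(2, ℝ)`. -/
noncomputable def diag (a : ℝˣ) : SL(2, ℝ) :=
  ⟨!![(a : ℝ), 0; 0, (a⁻¹ : ℝˣ)], by simp [Matrix.det_fin_two]⟩

@[simp] theorem coe_upper (x : ℝ) : (upper x).1 = !![1, x; 0, 1] := rfl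

@[simp] theorem coe_lower (x : ℝ) : (lower x).1 = !![1, 0; x, 1] := rfl

@[simp] theorem coe_diag (a : ℝˣ) : (diag a).1 = !![(a : ℝ), 0; 0, (a⁻¹ : ℝˣ)] := rfl

theorem coe_mul' (g h : SL(2, ℝ)) : (g * h).1 = g.1 * h.1 := rfl

theorem tendsto_of_entries {f : ℕ → SL(2, ℝ)} {g : SL(2, ℝ)}
    (h : ∀ i j, Tendsto (fun n => (f n).1 i j) atTop (𝓝 (g.1 i j))) : Tendsto f atTop (𝓝 g) := by
  refine tendsto_subtype_rng.2 (tendsto_pi_nhds.2 fun i => tendsto_pi_nhds.2 fun j => h i j)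

/-- The big Bruhat cell; `diag_mul_upper` handles its complement. -/
theorem upper_lower_upper (g : SL(2, ℝ)) (h : g.1 1 0 ≠ 0) :
    g = upper ((g.1 0 0 - 1) / g.1 1 0) * lower (g.1 1 0) * upper ((g.1 1 1 - 1) / g.1 1 0) := by
  have hd := g.2
  rw [Matrix.det_fin_two] at hd
  apply Subtype.ext
  simp only [coe_mul', coe_upper, coe_lower]
  ext i j
  fin_cases i <;> fin_cases j <;> simp [Matrix.mul_apply, Fin.sum_univ_two] <;> field_simp <;>
    linarith

theorem diag_mul_upper (g : SL(2, ℝ)) (h : g.1 1 0 = 0) :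
    ∃ a s, g = diag a * upper s := by
  have hd := g.2
  rw [Matrix.det_fin_two, h, mul_zero, sub_zero] at hd
  have h0 : g.1 0 0 ≠ 0 := left_ne_zero_of_mul_eq_one hd
  refine ⟨Units.mk0 _ h0, g.1 0 1 / g.1 0 0, Subtype.ext ?_⟩
  simp only [coe_mul', coe_upper, coe_diag]
  ext i j
  fin_cases i <;> fin_cases j <;> simp [Matrix.mul_apply, Fin.sum_univ_two, h] <;> field_simp
  linarith

theorem upper_mul_diag (a : ℝˣ) (s : ℝ) : diag a * upper s = upper (a ^ 2 * s) * diag a := by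
  apply Subtype.ext
  simp only [coe_mul', coe_upper, coe_diag]
  ext i j
  have := a.ne_zero
  fin_cases i <;> fin_cases j <;> simp [Matrix.mul_apply, Fin.sum_univ_two] <;> field_simp

theorem lower_mul_diag (a : ℝˣ) (s : ℝ) : lower s = diag a⁻¹ * lower (s / a ^ 2) * diag a := by
  apply Subtype.ext
  simp only [coe_mul', coe_lower, coe_diag]
  ext i j
  have := a.ne_zero
  fin_cases i <;> fin_cases j <;> simp [Matrix.mul_apply, Fin.sum_univ_two] <;> field_simp

theorem diag_mul_diag (a b : ℝˣ) : diag (a * b) = diag a * diag b := by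
  apply Subtype.ext
  simp only [coe_mul', coe_diag]
  ext i j
  fin_cases i <;> fin_cases j <;> simp [Matrix.mul_apply, Fin.sum_univ_two, mul_comm]

theorem diag_one : diag 1 = 1 := by
  apply Subtype.ext
  rw [coe_diag]
  ext i j
  fin_cases i <;> fin_cases j <;> simp

/-- The heart of Mautner's argument: a diagonal element is a limit of members of double cosets of
the upper unipotent group whose middle terms tend to 1. A bi-invariant quantity is thus controlled
there by its behaviour near 1. -/
theorem tendsto_unipotent_diag (a : ℝˣ) :
    ∃ x y e : ℕ → ℝ, Tendsto e atTop (𝓝 0) ∧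
      Tendsto (fun n => upper (x n) * lower (e n) * upper (y n)) atTop (𝓝 (diag a)) := by
  have he : Tendsto (fun n : ℕ => (1 / ((n : ℝ) + 1))) atTop (𝓝 0) :=
    tendsto_one_div_add_atTop_nhds_zero_nat
  -- These solve 1 + x e = a and 1 + y e = a⁻¹; determinant one then forces the upper right entry to
  -- vanish.
  refine ⟨fun n => (a - 1) * (n + 1), fun n => ((a⁻¹ : ℝˣ) - 1) * (n + 1), _, he, ?_⟩
  apply tendsto_of_entries
  have hn : ∀ n : ℕ, (n : ℝ) + 1 ≠ 0 := fun n => by positivity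
  have ha := a.ne_zero
  have key : ∀ n : ℕ, (upper ((a - 1) * (n + 1)) * lower (1 / ((n : ℝ) + 1)) *
      upper (((a⁻¹ : ℝˣ) - 1) * (n + 1))).1 =
      !![(a : ℝ), 0; 1 / ((n : ℝ) + 1), (a⁻¹ : ℝˣ)] := by
    intro n
    have := hn n
    simp only [coe_mul', coe_upper, coe_lower]
    ext i j
    fin_cases i <;> fin_cases j <;> simp [Matrix.mul_apply, Fin.sum_univ_two] <;> field_simp <;>
      ring
  simp_rw [key]
  intro i j
  fin_cases i <;> fin_cases j <;> simp
  simpa using he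

theorem tendsto_lower {e : ℕ → ℝ} (he : Tendsto e atTop (𝓝 0)) :
    Tendsto (fun n => lower (e n)) atTop (𝓝 1) := by
  apply tendsto_of_entries
  intro i j
  fin_cases i <;> fin_cases j <;> simp [he]

theorem exists_mulVec_eq {u : Fin 2 → ℝ} (hu : u ≠ 0) :
    ∃ g : SL(2, ℝ), g.1.mulVec ![1, 0] = u := by
  have hn : u 0 ^ 2 + u 1 ^ 2 ≠ 0 := by
    intro h
    apply hu
    ext i
    fin_cases i <;> simp <;> nlinarith [sq_nonneg (u 0), sq_nonneg (u 1)]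
  refine ⟨⟨!![u 0, -u 1 / (u 0 ^ 2 + u 1 ^ 2); u 1, u 0 / (u 0 ^ 2 + u 1 ^ 2)], ?_⟩, ?_⟩
  · rw [Matrix.det_fin_two]
    simp
    field_simp
    ring
  · ext i
    fin_cases i <;> simp [Matrix.mulVec, dotProduct]

variable {X : Type*} [TopologicalSpace X] [MulAction SL(2, ℝ) X]
  [ContinuousSMul SL(2, ℝ) X] [MulAction.IsPretransitive SL(2, ℝ) X] [MeasurableSpace X]
  [BorelSpace X]

/-- Mautner phenomenon for open sets: on a homogeneous space of finite volume, two nonempty open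
sets invariant under the upper unipotent group intersect. -/
theorem not_disjoint_of_upper_invariant (μ : Measure X) [IsFiniteMeasure μ]
    [SMulInvariantMeasure SL(2, ℝ) X μ]
    (hpos : ∀ O : Set X, IsOpen O → O.Nonempty → μ O ≠ 0)
    {U V : Set X} (hU : IsOpen U) (hV : IsOpen V) (hUne : U.Nonempty) (hVne : V.Nonempty)
    (hUn : ∀ s x, upper s • x ∈ U ↔ x ∈ U) (hVn : ∀ s x, upper s • x ∈ V ↔ x ∈ V) :
    ¬ Disjoint U V := by
  intro hUV
  have hdiag : ∀ a : ℝˣ, ∀ x ∈ U, diag a • x ∉ V := by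
    intro a
    obtain ⟨x, y, e, he, hlim⟩ := tendsto_unipotent_diag a
    refine smul_notMem_of_tendsto (μ := μ) hpos hU hV hlim ?_
    simp_rw [measure_inter_preimage_mul_mul (hUn _) (hVn _)]
    exact tendsto_measure_inter_preimage_of_disjoint hU hUV (tendsto_lower he)
  -- Saturating under the diagonal group keeps the sets open and unipotent-invariant, and by `hdiag`
  -- still disjoint.
  let U' : Set X := ⋃ a : ℝˣ, (fun x => diag a • x) ⁻¹' U
  let V' : Set X := ⋃ a : ℝˣ, (fun x => diag a • x) ⁻¹' V
  have hmem : ∀ (S : Set X), ∀ x : X, x ∈ (⋃ a : ℝˣ, (fun x => diag a • x) ⁻¹' S) ↔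
      ∃ a, diag a • x ∈ S := by simp
  have hU'o : IsOpen U' := isOpen_iUnion fun a => hU.preimage (continuous_const_smul _)
  have hV'o : IsOpen V' := isOpen_iUnion fun a => hV.preimage (continuous_const_smul _)
  have hUV' : Disjoint U' V' := by
    rw [disjoint_left]
    intro x hxU hxV
    obtain ⟨a, ha⟩ := (hmem U x).1 hxU
    obtain ⟨b, hb⟩ := (hmem V x).1 hxV
    apply hdiag (b * a⁻¹) _ ha
    rwa [smul_smul, ← diag_mul_diag, inv_mul_cancel_right]
  have hd : ∀ (S : Set X) (b : ℝˣ) (x : X),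
      diag b • x ∈ (⋃ a : ℝˣ, (fun x => diag a • x) ⁻¹' S) ↔
        x ∈ (⋃ a : ℝˣ, (fun x => diag a • x) ⁻¹' S) := by
    intro S b x
    rw [hmem, hmem]
    constructor
    · rintro ⟨a, ha⟩
      exact ⟨a * b, by rwa [diag_mul_diag, mul_smul]⟩
    · rintro ⟨a, ha⟩
      exact ⟨a * b⁻¹, by rwa [smul_smul, ← diag_mul_diag, inv_mul_cancel_right]⟩
  have hn : ∀ (S : Set X), (∀ s x, upper s • x ∈ S ↔ x ∈ S) → ∀ s x,
      (upper s • x ∈ (⋃ a : ℝˣ, (fun x => diag a • x) ⁻¹' S) ↔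
        x ∈ (⋃ a : ℝˣ, (fun x => diag a • x) ⁻¹' S)) := by
    intro S hS s x
    rw [hmem, hmem]
    refine exists_congr fun a => ?_
    rw [smul_smul, upper_mul_diag, mul_smul, hS]
  -- Conjugation by large diagonal elements shrinks lower unipotents to 1 without changing the
  -- overlap of U' and V'. This constant overlap therefore equals its limit 0.
  have hlower : ∀ s, ∀ x ∈ U', lower s • x ∉ V' := by
    intro s
    refine smul_notMem_of_tendsto (μ := μ) hpos hU'o hV'o
      (tendsto_const_nhds : Tendsto (fun _ : ℕ => lower s) atTop _) ?_
    have he : Tendsto (fun n : ℕ => s / ((n : ℝ) + 1) ^ 2) atTop (𝓝 0) := by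
      have h1 : Tendsto (fun n : ℕ => (1 / ((n : ℝ) + 1))) atTop (𝓝 0) :=
        tendsto_one_div_add_atTop_nhds_zero_nat
      have h2 := (h1.pow 2).const_mul s
      simpa [div_eq_mul_inv] using h2
    refine (tendsto_measure_inter_preimage_of_disjoint (μ := μ) hU'o hUV'
      (tendsto_lower he)).congr fun n => ?_
    have hne : ((n : ℝ) + 1) ≠ 0 := by positivity
    conv_rhs => rw [lower_mul_diag (Units.mk0 _ hne) s]
    exact (measure_inter_preimage_mul_mul (hd U _) (hd V _) _).symm
  obtain ⟨x, hx⟩ := hUne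
  obtain ⟨y, hy⟩ := hVne
  have hx' : x ∈ U' := (hmem U x).2 ⟨1, by rwa [diag_one, one_smul]⟩
  have hy' : y ∈ V' := (hmem V y).2 ⟨1, by rwa [diag_one, one_smul]⟩
  obtain ⟨g, rfl⟩ := MulAction.exists_smul_eq SL(2, ℝ) x y
  by_cases h : g.1 1 0 = 0
  · obtain ⟨a, s, rfl⟩ := diag_mul_upper g h
    rw [mul_smul] at hy'
    exact disjoint_left.1 hUV' ((hd U _ _).2 ((hn U hUn _ _).2 hx')) hy'
  · rw [upper_lower_upper g h, mul_smul, mul_smul] at hy'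
    exact hlower _ _ ((hn U hUn _ _).2 hx') ((hn V hVn _ _).1 hy')

end SL2

/-! ### Dynamics of a lattice: dense orbits in the plane and rank-one limits. -/

namespace IsLatticeSL2
open SL2

variable {Δ : Subgroup SL(2, ℝ)}

/-- A lattice acts on the plane in a topologically transitive way. -/
theorem exists_mulVec_mem (hΔ : IsLatticeSL2 Δ) {O O' : Set (Fin 2 → ℝ)} (hO : IsOpen O)
    (hO' : IsOpen O') (hne : O.Nonempty) (hne' : O'.Nonempty) :
    ∃ δ ∈ Δ, ∃ u ∈ O, δ.1.mulVec u ∈ O' := by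
  let _ : MeasurableSpace (SL(2, ℝ) ⧸ Δ) := borel _
  have _ : BorelSpace (SL(2, ℝ) ⧸ Δ) := ⟨rfl⟩
  obtain ⟨μ, hμ, hfin, hinv⟩ := hΔ.exists_measure
  have _ : SecondCountableTopology (Matrix (Fin 2) (Fin 2) ℝ) :=
    inferInstanceAs (SecondCountableTopology (Fin 2 → Fin 2 → ℝ))
  have _ : SecondCountableTopology SL(2, ℝ) :=
    Matrix.SpecialLinearGroup.isClosedEmbedding_val.isEmbedding.secondCountableTopology
  have hpos : ∀ O : Set (SL(2, ℝ) ⧸ Δ), IsOpen O → O.Nonempty → μ O ≠ 0 :=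
    fun O h1 h2 => measure_ne_zero_of_isOpen (G := SL(2, ℝ)) hμ h1 h2
  -- The upper unipotent group fixes e₁, so an open set of the plane yields an open
  -- unipotent-invariant set in the quotient. A common point of two such sets gives an element of Δ
  -- moving a vector of O into O'.
  let S : Set (Fin 2 → ℝ) → Set SL(2, ℝ) := fun O => {h | (h⁻¹).1.mulVec ![1, 0] ∈ O}
  let P : Set (Fin 2 → ℝ) → Set (SL(2, ℝ) ⧸ Δ) := fun O => QuotientGroup.mk '' S O
  have hcont : Continuous fun h : SL(2, ℝ) => (h⁻¹).1.mulVec (![1, 0] : Fin 2 → ℝ) :=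
    (continuous_subtype_val.comp (continuous_inv (G := SL(2, ℝ)))).matrix_mulVec continuous_const
  have hPo : ∀ O, IsOpen O → IsOpen (P O) := fun O hO =>
    QuotientGroup.isOpenMap_coe _ (hO.preimage hcont)
  have hPne : ∀ O : Set (Fin 2 → ℝ), IsOpen O → O.Nonempty → (P O).Nonempty := by
    intro O hO hne
    obtain ⟨u, hu, hu0⟩ := (dense_compl_singleton (0 : Fin 2 → ℝ)).inter_open_nonempty O hO hne
    obtain ⟨g, hg⟩ := exists_mulVec_eq hu0
    refine ⟨_, g⁻¹, ?_, rfl⟩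
    change ((g⁻¹)⁻¹).1.mulVec _ ∈ O
    rwa [inv_inv, hg]
  have hup : ∀ s, (upper s).1.mulVec (![1, 0] : Fin 2 → ℝ) = ![1, 0] := by
    intro s
    ext i
    fin_cases i <;> simp
  have hPn1 : ∀ O s x, x ∈ P O → upper s • x ∈ P O := by
    rintro O s _ ⟨h, hh, rfl⟩
    refine ⟨upper s * h, ?_, rfl⟩
    have hinv : (upper s)⁻¹.1.mulVec (![1, 0] : Fin 2 → ℝ) = ![1, 0] := by
      conv_lhs => rw [← hup s]
      rw [Matrix.mulVec_mulVec, ← coe_mul', inv_mul_cancel]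
      simp
    change ((upper s * h)⁻¹).1.mulVec _ ∈ O
    rw [mul_inv_rev, coe_mul', ← Matrix.mulVec_mulVec, hinv]
    exact hh
  have hPn : ∀ O s x, upper s • x ∈ P O ↔ x ∈ P O := by
    refine fun O s x => ⟨fun h => ?_, hPn1 O s x⟩
    have := hPn1 O (-s) _ h
    rwa [smul_smul, show upper (-s) * upper s = 1 from ?_, one_smul] at this
    apply Subtype.ext
    rw [coe_mul', coe_upper, coe_upper]
    ext i j
    fin_cases i <;> fin_cases j <;> simp
  have h := not_disjoint_of_upper_invariant μ hpos (hPo O hO) (hPo O' hO') (hPne O hO hne)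
    (hPne O' hO' hne') (hPn O) (hPn O')
  rw [not_disjoint_iff] at h
  obtain ⟨_, ⟨g, hg, rfl⟩, ⟨g', hg', hgg⟩⟩ := h
  replace hgg := hgg.symm
  rw [QuotientGroup.eq] at hgg
  refine ⟨_, Δ.inv_mem hgg, _, hg, ?_⟩
  have h1 : ((g⁻¹ * g')⁻¹) * g⁻¹ = g'⁻¹ := by group
  rw [Matrix.mulVec_mulVec, ← coe_mul', h1]
  exact hg'

/-- Every affine line that misses the origin contains a vector whose orbit under the lattice is
dense in the plane. -/
theorem exists_dense_orbit (hΔ : IsLatticeSL2 Δ) {k : Fin 2 → ℝ} (hk : k ≠ 0) {c : ℝ}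
    (hc : c ≠ 0) : ∃ y : Fin 2 → ℝ, k ⬝ᵥ y = c ∧ Dense {z | ∃ δ ∈ Δ, δ.1.mulVec y = z} := by
  let B := TopologicalSpace.countableBasis (Fin 2 → ℝ)
  let S : Set (Fin 2 → ℝ) → Set (Fin 2 → ℝ) := fun O => ⋃ δ ∈ Δ, {u | δ.1.mulVec u ∈ O}
  have hcont : ∀ δ : SL(2, ℝ), Continuous fun u : Fin 2 → ℝ => δ.1.mulVec u := fun δ =>
    continuous_const.matrix_mulVec continuous_id
  have hB : ∀ b ∈ B, IsOpen b := fun b hb => TopologicalSpace.isOpen_of_mem_countableBasis hb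
  -- Baire category: vectors in this intersection have orbits meeting every basic open set.
  have hS : Dense (⋂ b ∈ B, S b) := by
    refine dense_biInter_of_isOpen (fun b hb => ?_) (TopologicalSpace.countable_countableBasis _)
      (fun b hb => ?_)
    · exact isOpen_biUnion fun δ _ => (hB b hb).preimage (hcont δ)
    · rw [dense_iff_inter_open]
      intro V hV hVne
      obtain ⟨δ, hδ, u, hu, hu'⟩ := hΔ.exists_mulVec_mem hV (hB b hb) hVne
        (TopologicalSpace.nonempty_of_mem_countableBasis hb)
      exact ⟨u, hu, mem_biUnion hδ hu'⟩
  have hko : IsOpen {u : Fin 2 → ℝ | k ⬝ᵥ u ≠ 0} :=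
    isOpen_ne_fun (continuous_const.dotProduct continuous_id) continuous_const
  obtain ⟨u, hu, huS⟩ := hS.inter_open_nonempty _ hko ⟨k, dotProduct_self_eq_zero.not.2 hk⟩
  have hu : k ⬝ᵥ u ≠ 0 := hu
  have hdu : Dense {z | ∃ δ ∈ Δ, δ.1.mulVec u = z} := by
    rw [(TopologicalSpace.isBasis_countableBasis (Fin 2 → ℝ)).dense_iff]
    intro b hb _
    have h1 := mem_iInter₂.1 huS b hb
    obtain ⟨δ, hδ, h⟩ := mem_iUnion₂.1 h1
    exact ⟨_, h, δ, hδ, rfl⟩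
  -- Scalars commute with Δ, so u may be rescaled onto the prescribed line with its orbit still
  -- dense.
  have hne : c / (k ⬝ᵥ u) ≠ 0 := div_ne_zero hc hu
  refine ⟨(c / (k ⬝ᵥ u)) • u, by rw [dotProduct_smul, smul_eq_mul, div_mul_cancel₀ _ hu], ?_⟩
  have h2 := (Homeomorph.smulOfNeZero _ hne).surjective.denseRange.dense_image
    (Homeomorph.smulOfNeZero _ hne).continuous hdu
  refine h2.mono ?_
  rintro _ ⟨_, ⟨δ, hδ, rfl⟩, rfl⟩
  exact ⟨δ, hδ, by rw [Matrix.mulVec_smul]; rfl⟩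

/-- Suitable multiples of elements of a lattice converge to any given conjugate of the projection
onto the first axis. -/
theorem exists_tendsto_projection (hΔ : IsLatticeSL2 Δ) (k : SL(2, ℝ)) :
    ∃ (δ : ℕ → SL(2, ℝ)) (c : ℕ → ℝ), (∀ n, δ n ∈ Δ) ∧ (∀ n, c n ≠ 0) ∧
      Tendsto c atTop (𝓝 0) ∧
      Tendsto (fun n => c n • (δ n).1) atTop (𝓝 ((k⁻¹).1 * !![1, 0; 0, 0] * k.1)) := by
  let _ : MeasurableSpace (SL(2, ℝ) ⧸ Δ) := borel _
  have _ : BorelSpace (SL(2, ℝ) ⧸ Δ) := ⟨rfl⟩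
  obtain ⟨μ, hμ, hfin, hinv⟩ := hΔ.exists_measure
  have _ : SecondCountableTopology (Matrix (Fin 2) (Fin 2) ℝ) :=
    inferInstanceAs (SecondCountableTopology (Fin 2 → Fin 2 → ℝ))
  have _ : SecondCountableTopology SL(2, ℝ) :=
    Matrix.SpecialLinearGroup.isClosedEmbedding_val.isEmbedding.secondCountableTopology
  obtain ⟨B, hB⟩ := (𝓝 k).exists_antitone_basis
  have h2 : (2 : ℝ) ≠ 0 := two_ne_zero
  -- Recurrence to ever smaller neighbourhoods of kΔ. As b and b' tend to k, the lattice element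
  -- behaves like k⁻¹ diag(2ᵐ, 2⁻ᵐ) k, and scaling by 2⁻ᵐ leaves the projection.
  have hstep : ∀ n : ℕ, ∃ m ≥ n, ∃ b ∈ B n, ∃ b' ∈ B n,
      b'⁻¹ * diag (Units.mk0 2 h2 ^ m) * b ∈ Δ := by
    intro n
    obtain ⟨V, hVB, hV, hkV⟩ := mem_nhds_iff.1 (hB.1.mem_of_mem (i := n) trivial)
    have hO : IsOpen ((QuotientGroup.mk : SL(2, ℝ) → SL(2, ℝ) ⧸ Δ) '' V) :=
      QuotientGroup.isOpenMap_coe _ hV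
    obtain ⟨m, hm, _, ⟨b, hb, rfl⟩, ⟨b', hb', hbb⟩⟩ :=
      frequently_atTop.1 (frequently_exists_pow_smul_mem (μ := μ) (diag (Units.mk0 2 h2)) hO
        (measure_ne_zero_of_isOpen (G := SL(2, ℝ)) hμ hO ⟨_, k, hkV, rfl⟩)) n
    refine ⟨m, hm, b, hVB hb, b', hVB hb', ?_⟩
    have hpow : diag (Units.mk0 2 h2 ^ m) = diag (Units.mk0 2 h2) ^ m := by
      clear hbb hm
      induction m with
      | zero => simp [diag_one]
      | succ m ih => rw [pow_succ, pow_succ, diag_mul_diag, ih]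
    have h3 : (QuotientGroup.mk b' : SL(2, ℝ) ⧸ Δ) =
        QuotientGroup.mk (diag (Units.mk0 2 h2) ^ m * b) := hbb
    rw [QuotientGroup.eq] at h3
    rwa [hpow, mul_assoc]
  choose m hm b hb b' hb' hΔ' using hstep
  have hm' : Tendsto m atTop atTop := tendsto_atTop_mono hm tendsto_id
  have htb : Tendsto b atTop (𝓝 k) := hB.tendsto hb
  have htb' : Tendsto b' atTop (𝓝 k) := hB.tendsto hb'
  have hc : Tendsto (fun n => (1 / 2 : ℝ) ^ m n) atTop (𝓝 0) :=
    (tendsto_pow_atTop_nhds_zero_of_lt_one (by norm_num) (by norm_num)).comp hm'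
  refine ⟨_, fun n => (1 / 2 : ℝ) ^ m n, hΔ', fun n => by positivity, hc, ?_⟩
  have hdiag : Tendsto (fun n => (1 / 2 : ℝ) ^ m n • (diag (Units.mk0 2 h2 ^ m n)).1) atTop
      (𝓝 !![1, 0; 0, 0]) := by
    have h4 : ∀ n, (1 / 2 : ℝ) ^ m n • (diag (Units.mk0 2 h2 ^ m n)).1 =
        !![1, 0; 0, (1 / 2 : ℝ) ^ m n * (1 / 2 : ℝ) ^ m n] := by
      intro n
      ext i j
      fin_cases i <;> fin_cases j <;> simp
    simp_rw [h4]
    refine tendsto_pi_nhds.2 fun i => tendsto_pi_nhds.2 fun j => ?_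
    fin_cases i <;> fin_cases j <;> simp
    simpa using hc.mul hc
  have hv : Continuous (fun g : SL(2, ℝ) => g.1) := continuous_subtype_val
  have h5 := (((hv.tendsto _).comp htb'.inv).mul hdiag).mul ((hv.tendsto _).comp htb)
  refine h5.congr fun n => ?_
  rw [coe_mul', coe_mul', Matrix.mul_smul, Matrix.smul_mul]
  rfl

end IsLatticeSL2

open Matrix

/-! ### Vectors, functionals and block matrices in dimension three. -/

namespace SL3

/-- The action of `g` on linear functionals, by the inverse transpose. -/
def dual (g : SL(3, ℝ)) : Matrix (Fin 3) (Fin 3) ℝ := (g⁻¹).1ᵀ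

theorem coe_mul' (g h : SL(3, ℝ)) : (g * h).1 = g.1 * h.1 := rfl

theorem dual_mul (g h : SL(3, ℝ)) : dual (g * h) = dual g * dual h := by
  rw [dual, _root_.mul_inv_rev, coe_mul', transpose_mul, dual, dual]

theorem dual_eq_adjugate (g : SL(3, ℝ)) : dual g = g.1.adjugateᵀ := rfl

/-- The cofactor matrix is the exterior square of M, read through the cross product. -/
theorem cross_mulVec (M : Matrix (Fin 3) (Fin 3) ℝ) (u v : Fin 3 → ℝ) :
    crossProduct (M.mulVec u) (M.mulVec v) = M.adjugateᵀ.mulVec (crossProduct u v) := by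
  ext i
  fin_cases i <;>
    simp [cross_apply, adjugate_fin_three, mulVec, dotProduct, Fin.sum_univ_three] <;> ring

theorem mulVec_cross (g : SL(3, ℝ)) (u v : Fin 3 → ℝ) :
    g.1.mulVec (crossProduct u v) = crossProduct ((dual g).mulVec u) ((dual g).mulVec v) := by
  rw [cross_mulVec, dual, adjugate_transpose, transpose_transpose]
  congr 1
  exact congrArg Subtype.val (inv_inv g).symm

theorem dual_mulVec_transpose (g : SL(3, ℝ)) (f : Fin 3 → ℝ) :
    (dual g).mulVec (g.1ᵀ.mulVec f) = f := by
  rw [mulVec_mulVec, dual, ← transpose_mul, ← coe_mul', mul_inv_cancel]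
  exact (congrArg (fun M => mulVec M f) transpose_one).trans (one_mulVec f)

theorem mulVec_inv_mulVec (g : SL(3, ℝ)) (x : Fin 3 → ℝ) :
    g.1.mulVec ((g⁻¹).1.mulVec x) = x := by
  rw [mulVec_mulVec, ← coe_mul', mul_inv_cancel]
  exact one_mulVec x

theorem inv_mulVec_mulVec (g : SL(3, ℝ)) (x : Fin 3 → ℝ) :
    (g⁻¹).1.mulVec (g.1.mulVec x) = x := by
  rw [mulVec_mulVec, ← coe_mul', inv_mul_cancel]
  exact one_mulVec x

theorem dual_mulVec_dotProduct (g : SL(3, ℝ)) (f x : Fin 3 → ℝ) :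
    (dual g).mulVec f ⬝ᵥ x = f ⬝ᵥ (g⁻¹).1.mulVec x := by
  rw [dual, mulVec_transpose, dotProduct_mulVec]

theorem mulVec_ne_zero (g : SL(3, ℝ)) {x : Fin 3 → ℝ} (hx : x ≠ 0) : g.1.mulVec x ≠ 0 := by
  intro h
  apply hx
  rw [← inv_mulVec_mulVec g x, h, mulVec_zero]

/-- The block diagonal embedding of `SL(2, ℝ)` into `SL(3, ℝ)`. -/
def block (δ : SL(2, ℝ)) : SL(3, ℝ) :=
  ⟨!![δ.1 0 0, δ.1 0 1, 0; δ.1 1 0, δ.1 1 1, 0; 0, 0, 1], by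
    have := δ.2
    rw [det_fin_two] at this
    simp [det_fin_three, this]⟩

theorem coe_block (δ : SL(2, ℝ)) :
    (block δ).1 = !![δ.1 0 0, δ.1 0 1, 0; δ.1 1 0, δ.1 1 1, 0; 0, 0, 1] := rfl

theorem dual_block (δ : SL(2, ℝ)) :
    dual (block δ) = !![δ.1 1 1, -δ.1 1 0, 0; -δ.1 0 1, δ.1 0 0, 0; 0, 0, 1] := by
  have := δ.2
  rw [det_fin_two] at this
  rw [dual_eq_adjugate, coe_block]
  ext i j
  fin_cases i <;> fin_cases j <;> simp [adjugate_fin_three, this]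

end SL3

/-! ### General position from Zariski density. -/

open SL3

/-- Several nonvanishing conditions are met at once by multiplying their polynomials and exhibiting
one matrix where the product is nonzero. -/
theorem IsZariskiDense.exists_eval_ne_zero {S : Set SL(3, ℝ)} (hS : IsZariskiDense S)
    (p : MvPolynomial (Fin 3 × Fin 3) ℝ)
    (h : ∃ g : SL(3, ℝ), MvPolynomial.eval (fun ij => g.1 ij.1 ij.2) p ≠ 0) :
    ∃ g ∈ S, MvPolynomial.eval (fun ij => (g : SL(3, ℝ)).1 ij.1 ij.2) p ≠ 0 := by
  by_contra! hc
  obtain ⟨g, hg⟩ := h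
  exact hg (hS p hc g)

/-- The generic three by three matrix. -/
noncomputable def genericMatrix : Matrix (Fin 3) (Fin 3) (MvPolynomial (Fin 3 × Fin 3) ℝ) :=
  Matrix.of fun i j => MvPolynomial.X (i, j)

theorem eval_genericMatrix (g : Matrix (Fin 3) (Fin 3) ℝ) :
    genericMatrix.map (MvPolynomial.eval fun ij => g ij.1 ij.2) = g := by
  ext i j
  simp [genericMatrix]

theorem eval_genericMatrix_mulVec (g : Matrix (Fin 3) (Fin 3) ℝ) (x : Fin 3 → ℝ) (i : Fin 3) :
    MvPolynomial.eval (fun ij => g ij.1 ij.2)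
      (genericMatrix.mulVec (fun j => MvPolynomial.C (x j)) i) = g.mulVec x i := by
  rw [RingHom.map_mulVec, eval_genericMatrix]
  congr 1
  ext j
  simp

theorem eval_genericMatrix_adjugate_mulVec (g : Matrix (Fin 3) (Fin 3) ℝ) (x : Fin 3 → ℝ)
    (i : Fin 3) :
    MvPolynomial.eval (fun ij => g ij.1 ij.2)
      (genericMatrix.adjugateᵀ.mulVec (fun j => MvPolynomial.C (x j)) i) =
      g.adjugateᵀ.mulVec x i := by
  rw [RingHom.map_mulVec, transpose_map]
  have h := RingHom.map_adjugate (MvPolynomial.eval fun ij => g ij.1 ij.2) genericMatrix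
  rw [RingHom.mapMatrix_apply, RingHom.mapMatrix_apply, eval_genericMatrix] at h
  rw [h]
  congr 1
  ext j
  simp

theorem dotProduct_self_pos {x : Fin 3 → ℝ} (hx : x ≠ 0) : 0 < x ⬝ᵥ x :=
  lt_of_le_of_ne (Finset.sum_nonneg fun i _ => mul_self_nonneg (x i))
    (Ne.symm (dotProduct_self_eq_zero.not.2 hx))

/-- A Zariski-dense set moves any given flag into general position. -/
theorem IsZariskiDense.exists_general_position {S : Set SL(3, ℝ)} (hS : IsZariskiDense S)
    {x f : Fin 3 → ℝ} (hx : x ≠ 0) (hf : f ≠ 0) (hxf : x ⬝ᵥ f = 0) :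
    ∃ g ∈ S, g.1.mulVec x 0 ≠ 0 ∧ (dual g).mulVec f 1 ≠ 0 := by
  have hx2 : 0 < x ⬝ᵥ x := dotProduct_self_pos hx
  have hf2 : 0 < f ⬝ᵥ f := dotProduct_self_pos hf
  set u := crossProduct x f with hu
  have hu2 : u ⬝ᵥ u = (x ⬝ᵥ x) * (f ⬝ᵥ f) := by
    rw [hu, cross_dot_cross, hxf, dotProduct_comm f x, hxf]
    ring
  set c : ℝ := ((x ⬝ᵥ x) * (u ⬝ᵥ u))⁻¹ with hc
  have hc0 : c * ((x ⬝ᵥ x) * (u ⬝ᵥ u)) = 1 := by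
    refine inv_mul_cancel₀ ?_
    rw [hu2]
    positivity
  -- The rows form an orthogonal basis. The first pairs with x to x ⬝ᵥ x, and the second cofactor
  -- row u × x is a positive multiple of f.
  have hdet : (Matrix.of ![x, c • crossProduct u x, u]).det = 1 := by
    rw [← hc0, det_fin_three]
    simp [hu, cross_apply, dotProduct, Fin.sum_univ_three]
    ring
  obtain ⟨g, hg, hne⟩ := hS.exists_eval_ne_zero
    (genericMatrix.mulVec (fun j => MvPolynomial.C (x j)) 0 *
      genericMatrix.adjugateᵀ.mulVec (fun j => MvPolynomial.C (f j)) 1) ⟨⟨_, hdet⟩, by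
    rw [map_mul, eval_genericMatrix_mulVec, eval_genericMatrix_adjugate_mulVec]
    refine mul_ne_zero hx2.ne' ?_
    have : (Matrix.of ![x, c • crossProduct u x, u]).adjugateᵀ.mulVec f 1 = u ⬝ᵥ u := by
      simp [hu, cross_apply, adjugate_fin_three, mulVec, dotProduct, Fin.sum_univ_three]
      ring
    rw [this, hu2]
    positivity⟩
  rw [map_mul, eval_genericMatrix_mulVec, eval_genericMatrix_adjugate_mulVec] at hne
  exact ⟨g, hg, left_ne_zero_of_mul hne, right_ne_zero_of_mul hne⟩

/-- The first two conditions let rank-one limits send ge₃ to e₁ and gU to the plane with functional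
e₂. The last two make gU meet height one in an affine line missing the axis. -/
theorem IsZariskiDense.exists_transverse {S : Set SL(3, ℝ)} (hS : IsZariskiDense S) :
    ∃ g ∈ S, g.1.mulVec ![0, 0, 1] 0 ≠ 0 ∧ (dual g).mulVec ![0, 0, 1] 1 ≠ 0 ∧
      (dual g).mulVec ![0, 0, 1] 2 ≠ 0 := by
  have hdet : (!![1, 0, 1; 0, 1, 0; 0, 1, 1] : Matrix (Fin 3) (Fin 3) ℝ).det = 1 := by
    simp [det_fin_three]
  obtain ⟨g, hg, hne⟩ := hS.exists_eval_ne_zero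
    (genericMatrix.mulVec (fun j => MvPolynomial.C ((![0, 0, 1] : Fin 3 → ℝ) j)) 0 *
      (genericMatrix.adjugateᵀ.mulVec (fun j => MvPolynomial.C ((![0, 0, 1] : Fin 3 → ℝ) j)) 1 *
      genericMatrix.adjugateᵀ.mulVec (fun j => MvPolynomial.C ((![0, 0, 1] : Fin 3 → ℝ) j)) 2))
    ⟨⟨_, hdet⟩, by
      rw [map_mul, map_mul, eval_genericMatrix_mulVec, eval_genericMatrix_adjugate_mulVec,
        eval_genericMatrix_adjugate_mulVec]
      simp [adjugate_fin_three, mulVec, dotProduct, Fin.sum_univ_three]⟩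
  rw [map_mul, map_mul, eval_genericMatrix_mulVec, eval_genericMatrix_adjugate_mulVec,
    eval_genericMatrix_adjugate_mulVec] at hne
  exact ⟨g, hg, left_ne_zero_of_mul hne, left_ne_zero_of_mul (right_ne_zero_of_mul hne),
    right_ne_zero_of_mul (right_ne_zero_of_mul hne)⟩

/-! ### Closed invariant sets of flags: the horizontal circle and its translates. -/

/-- A closed `Γ`-invariant set of flags, each flag given by a vector spanning its line and a
functional whose kernel is its plane. -/
structure IsInvariantFlagSet (Γ : Subgroup SL(3, ℝ)) (Z : (Fin 3 → ℝ) → (Fin 3 → ℝ) → Prop) :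
    Prop where
  ne_left : ∀ {x f}, Z x f → x ≠ 0
  ne_right : ∀ {x f}, Z x f → f ≠ 0
  orthogonal : ∀ {x f}, Z x f → x ⬝ᵥ f = 0
  smul : ∀ {x f} (a b : ℝ), a ≠ 0 → b ≠ 0 → Z x f → Z (a • x) (b • f)
  act : ∀ {x f} (g : SL(3, ℝ)), g ∈ Γ → Z x f → Z (g.1.mulVec x) ((dual g).mulVec f)
  limit : ∀ {x f : Fin 3 → ℝ} {xs fs : ℕ → Fin 3 → ℝ}, x ≠ 0 → f ≠ 0 →
    Tendsto xs atTop (𝓝 x) → Tendsto fs atTop (𝓝 f) → (∀ᶠ n in atTop, Z (xs n) (fs n)) → Z x f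

/-- Elements of a lattice approximating, up to scale, the rank one matrix with columns `α • p` and
`β • p`. -/
theorem IsLatticeSL2.exists_tendsto_rankOne {Δ : Subgroup SL(2, ℝ)} (hΔ : IsLatticeSL2 Δ)
    {α β p q : ℝ} (h : α * p + β * q = 1) :
    ∃ (δ : ℕ → SL(2, ℝ)) (c : ℕ → ℝ), (∀ n, δ n ∈ Δ) ∧ (∀ n, c n ≠ 0) ∧
      Tendsto c atTop (𝓝 0) ∧
      Tendsto (fun n => c n * (δ n).1 0 0) atTop (𝓝 (α * p)) ∧
      Tendsto (fun n => c n * (δ n).1 0 1) atTop (𝓝 (β * p)) ∧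
      Tendsto (fun n => c n * (δ n).1 1 0) atTop (𝓝 (α * q)) ∧
      Tendsto (fun n => c n * (δ n).1 1 1) atTop (𝓝 (β * q)) := by
  -- The conjugator has first row (α, β), and its inverse has first column (p, q).
  have hdet : (!![α, β; -q, p] : Matrix (Fin 2) (Fin 2) ℝ).det = 1 := by
    rw [det_fin_two]
    simp
    linarith
  obtain ⟨δ, c, hδ, hc, hc0, hlim⟩ := hΔ.exists_tendsto_projection ⟨_, hdet⟩
  have hk : (!![α, β; -q, p]).adjugate * !![1, 0; 0, 0] * !![α, β; -q, p] =
      !![α * p, β * p; α * q, β * q] := by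
    rw [adjugate_fin_two]
    ext i j
    fin_cases i <;> fin_cases j <;> simp [mul_comm]
  change Tendsto _ _ (𝓝 ((!![α, β; -q, p]).adjugate * !![1, 0; 0, 0] * !![α, β; -q, p])) at hlim
  rw [hk] at hlim
  have hij := fun i j => tendsto_pi_nhds.1 (tendsto_pi_nhds.1 hlim i) j
  exact ⟨δ, c, hδ, hc, hc0, hij 0 0, hij 0 1, hij 1 0, hij 1 1⟩

theorem tendsto_vec3 {a b c : ℕ → ℝ} {x y z : ℝ} (ha : Tendsto a atTop (𝓝 x))
    (hb : Tendsto b atTop (𝓝 y)) (hc : Tendsto c atTop (𝓝 z)) :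
    Tendsto (fun n => ![a n, b n, c n]) atTop (𝓝 ![x, y, z]) := by
  refine tendsto_pi_nhds.2 fun i => ?_
  fin_cases i <;> simpa

theorem smul_block_mulVec (c : ℝ) (δ : SL(2, ℝ)) (x : Fin 3 → ℝ) :
    c • (block δ).1.mulVec x = ![c * δ.1 0 0 * x 0 + c * δ.1 0 1 * x 1,
      c * δ.1 1 0 * x 0 + c * δ.1 1 1 * x 1, c * x 2] := by
  ext i
  fin_cases i <;> simp [coe_block, dotProduct, Fin.sum_univ_three] <;> ring

theorem smul_dual_block_mulVec (c : ℝ) (δ : SL(2, ℝ)) (x : Fin 3 → ℝ) :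
    c • (dual (block δ)).mulVec x = ![c * δ.1 1 1 * x 0 - c * δ.1 1 0 * x 1,
      c * δ.1 0 0 * x 1 - c * δ.1 0 1 * x 0, c * x 2] := by
  ext i
  fin_cases i <;> simp [dual_block, dotProduct, Fin.sum_univ_three] <;> ring

namespace IsInvariantFlagSet

variable {Γ : Subgroup SL(3, ℝ)} {Z : (Fin 3 → ℝ) → (Fin 3 → ℝ) → Prop} {Δ : Subgroup SL(2, ℝ)}

theorem of_projection (hZ : IsInvariantFlagSet Γ Z) (hΔ : IsLatticeSL2 Δ)
    (hΔΓ : ∀ δ ∈ Δ, block δ ∈ Γ) {x f : Fin 3 → ℝ} (hxf : Z x f) {α β p q : ℝ}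
    (h : α * p + β * q = 1) (hx : α * x 0 + β * x 1 ≠ 0) (hf : α * f 1 - β * f 0 ≠ 0) :
    Z ![p, q, 0] ![-q, p, 0] := by
  obtain ⟨δ, c, hδ, hc, hc0, h00, h01, h10, h11⟩ := hΔ.exists_tendsto_rankOne h
  have hpq : ¬ (p = 0 ∧ q = 0) := by
    rintro ⟨rfl, rfl⟩
    simp at h
  have h1 := tendsto_vec3 ((h00.mul_const (x 0)).add (h01.mul_const (x 1)))
    ((h10.mul_const (x 0)).add (h11.mul_const (x 1))) (hc0.mul_const (x 2))
  have h2 := tendsto_vec3 ((h11.mul_const (f 0)).sub (h10.mul_const (f 1)))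
    ((h00.mul_const (f 1)).sub (h01.mul_const (f 0))) (hc0.mul_const (f 2))
  simp_rw [← smul_block_mulVec] at h1
  simp_rw [← smul_dual_block_mulVec] at h2
  have e1 : ![α * p * x 0 + β * p * x 1, α * q * x 0 + β * q * x 1, 0 * x 2] =
      (α * x 0 + β * x 1) • ![p, q, 0] := by
    ext i
    fin_cases i <;> simp <;> ring
  have e2 : ![β * q * f 0 - α * q * f 1, α * p * f 1 - β * p * f 0, 0 * f 2] =
      (α * f 1 - β * f 0) • ![-q, p, 0] := by
    ext i
    fin_cases i <;> simp <;> ring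
  rw [e1] at h1
  rw [e2] at h2
  have hlim := hZ.limit (smul_ne_zero hx ?_) (smul_ne_zero hf ?_) h1 h2
    (Eventually.of_forall fun n =>
      hZ.smul (c n) (c n) (hc n) (hc n) (hZ.act _ (hΔΓ _ (hδ n)) hxf))
  · have := hZ.smul _ _ (inv_ne_zero hx) (inv_ne_zero hf) hlim
    rwa [inv_smul_smul₀ hx, inv_smul_smul₀ hf] at this
  · exact fun h0 => hpq ⟨by simpa using congrFun h0 0, by simpa using congrFun h0 1⟩
  · exact fun h0 => hpq ⟨by simpa using congrFun h0 1, by simpa using congrFun h0 0⟩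

/-- A nonempty invariant set contains all flags whose line is horizontal and whose plane is
vertical. -/
theorem horizontal (hZ : IsInvariantFlagSet Γ Z) (hΔ : IsLatticeSL2 Δ)
    (hΔΓ : ∀ δ ∈ Δ, block δ ∈ Γ) (hΓ : IsZariskiDense (Γ : Set SL(3, ℝ)))
    {x f : Fin 3 → ℝ} (hxf : Z x f) {p q : ℝ} (hpq : p ≠ 0 ∨ q ≠ 0) :
    Z ![p, q, 0] ![-q, p, 0] := by
  obtain ⟨g, hg, hx, hf⟩ :=
    hΓ.exists_general_position (hZ.ne_left hxf) (hZ.ne_right hxf) (hZ.orthogonal hxf)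
  -- From this one flag every other is reached, because both nonvanishing conditions of
  -- `of_projection` reduce to α ≠ 0.
  have h1 : Z ![1, 0, 0] ![-0, 1, 0] :=
    hZ.of_projection hΔ hΔΓ (hZ.act g hg hxf) (α := 1) (β := 0) (by simp) (by simpa using hx)
      (by simpa using hf)
  by_cases hp : p = 0
  · have hq : q ≠ 0 := hpq.resolve_left (not_not.2 hp)
    exact hZ.of_projection hΔ hΔΓ h1 (α := 1) (β := q⁻¹) (by simp [hp, hq]) (by simp) (by simp)
  · exact hZ.of_projection hΔ hΔΓ h1 (α := p⁻¹) (β := 0) (by simp [hp]) (by simp [hp])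
      (by simp [hp])

/-- The functional `(dual g).mulVec ![0, 0, 1]` cuts out gU, so the cross product spans the
intersection of gU with the plane of F. Pulled back by g, this is a flag with horizontal line and
plane through e₃. -/
theorem translate_horizontal (hZ : IsInvariantFlagSet Γ Z)
    (hC : ∀ p q : ℝ, p ≠ 0 ∨ q ≠ 0 → Z ![p, q, 0] ![-q, p, 0]) {g : SL(3, ℝ)} (hg : g ∈ Γ)
    {F : Fin 3 → ℝ} (hF : F ≠ 0) (hFg : F ⬝ᵥ g.1.mulVec ![0, 0, 1] = 0) :
    Z (crossProduct F ((dual g).mulVec ![0, 0, 1])) F := by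
  set G := g.1ᵀ.mulVec F with hG
  have hG2 : G 2 = 0 := by
    rw [dotProduct_mulVec, ← mulVec_transpose, ← hG] at hFg
    simpa [dotProduct, Fin.sum_univ_three] using hFg
  have hGF : (dual g).mulVec G = F := dual_mulVec_transpose g F
  have hG0 : G ≠ 0 := by
    intro h
    rw [h, mulVec_zero] at hGF
    exact hF hGF.symm
  have h1 := hZ.act g hg (hC (G 1) (-G 0) (by
    by_contra! h
    apply hG0
    ext i
    fin_cases i
    · simpa using h.2
    · simpa using h.1
    · simpa using hG2))
  have e1 : ![-(-G 0), G 1, 0] = G := by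
    ext i
    fin_cases i <;> simp [hG2]
  have e2 : ![G 1, -G 0, 0] = crossProduct G ![0, 0, 1] := by
    ext i
    fin_cases i <;> simp [cross_apply]
  rwa [e1, e2, mulVec_cross, hGF] at h1

theorem base_line (hZ : IsInvariantFlagSet Γ Z) (hΔ : IsLatticeSL2 Δ)
    (hΔΓ : ∀ δ ∈ Δ, block δ ∈ Γ)
    (hC : ∀ p q : ℝ, p ≠ 0 ∨ q ≠ 0 → Z ![p, q, 0] ![-q, p, 0]) {g : SL(3, ℝ)} (hg : g ∈ Γ)
    (hg0 : g.1.mulVec ![0, 0, 1] 0 ≠ 0) (hg1 : (dual g).mulVec ![0, 0, 1] 1 ≠ 0)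
    {a : ℝ} (ha : a ≠ 0) : Z ![1, 0, 0] ![0, 1, a] := by
  obtain ⟨δ, c, hδ, hc, hc0, h00, h01, h10, h11⟩ :=
    hΔ.exists_tendsto_rankOne (α := 1) (β := 0) (p := 1) (q := 0) (by simp)
  simp only [one_mul, zero_mul, mul_zero] at h00 h01 h10 h11
  set w := g.1.mulVec ![0, 0, 1]
  set k := (dual g).mulVec ![0, 0, 1]
  let z : ℕ → Fin 3 → ℝ := fun n => c n • (block (δ n)).1.mulVec w
  let l : ℕ → Fin 3 → ℝ := fun n => c n • (dual (block (δ n))).mulVec k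
  have hz : Tendsto z atTop (𝓝 ![w 0, 0, 0]) := by
    have h := tendsto_vec3 ((h00.mul_const (w 0)).add (h01.mul_const (w 1)))
      ((h10.mul_const (w 0)).add (h11.mul_const (w 1))) (hc0.mul_const (w 2))
    simp_rw [← smul_block_mulVec] at h
    simpa using h
  have hl : Tendsto l atTop (𝓝 ![0, k 1, 0]) := by
    have h := tendsto_vec3 ((h11.mul_const (k 0)).sub (h10.mul_const (k 1)))
      ((h00.mul_const (k 1)).sub (h01.mul_const (k 0))) (hc0.mul_const (k 2))
    simp_rw [← smul_dual_block_mulVec] at h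
    simpa using h
  have hzi := tendsto_pi_nhds.1 hz
  have hli := tendsto_pi_nhds.1 hl
  -- Chosen so that the functional (t, 1, a) kills z n, that is, its plane contains the translated
  -- axis.
  let t : ℕ → ℝ := fun n => -(z n 1 + a * z n 2) / z n 0
  have ht : Tendsto t atTop (𝓝 0) := by
    have h := ((hzi 1).add ((hzi 2).const_mul a)).neg.div (hzi 0) hg0
    have e : -((![w 0, 0, 0] : Fin 3 → ℝ) 1 + a * (![w 0, 0, 0] : Fin 3 → ℝ) 2) /
        (![w 0, 0, 0] : Fin 3 → ℝ) 0 = 0 := by simp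
    rwa [e] at h
  let F : ℕ → Fin 3 → ℝ := fun n => ![t n, 1, a]
  have hF : Tendsto F atTop (𝓝 ![0, 1, a]) :=
    tendsto_vec3 ht tendsto_const_nhds tendsto_const_nhds
  have hX : Tendsto (fun n => crossProduct (F n) (l n)) atTop (𝓝 ((-(a * k 1)) • ![1, 0, 0])) := by
    have h := tendsto_vec3 (((hli 2).const_mul 1).sub ((hli 1).const_mul a))
      (((hli 0).const_mul a).sub (ht.mul (hli 2)))
      ((ht.mul (hli 1)).sub ((hli 0).const_mul 1))
    have e : ∀ n, crossProduct (F n) (l n) =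
        ![1 * l n 2 - a * l n 1, a * l n 0 - t n * l n 2, t n * l n 1 - 1 * l n 0] := by
      intro n
      simp [cross_apply, F]
    simp_rw [e]
    simpa using h
  -- For a = 0 the limit plane would coincide with the limit of the translates of U, and the
  -- intersection line would be undetermined.
  have hak : -(a * k 1) ≠ 0 := neg_ne_zero.2 (mul_ne_zero ha hg1)
  have hlim := hZ.limit (smul_ne_zero hak fun h => by simpa using congrFun h 0)
    (fun h => by simpa using congrFun h 1) hX hF ?_
  · have := hZ.smul _ _ (inv_ne_zero hak) one_ne_zero hlim
    rwa [inv_smul_smul₀ hak, one_smul] at this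
  · filter_upwards [(hzi 0).eventually_ne hg0] with n hn
    have h1 : F n ⬝ᵥ z n = 0 := by
      simp only [dotProduct, Fin.sum_univ_three, F, t]
      simp
      field_simp
      ring
    have h2 : F n ⬝ᵥ (block (δ n) * g).1.mulVec ![0, 0, 1] = 0 := by
      rw [SL3.coe_mul', ← mulVec_mulVec]
      have h3 : F n ⬝ᵥ (c n • (block (δ n)).1.mulVec w) = 0 := h1
      rw [dotProduct_smul, smul_eq_mul] at h3
      exact (mul_eq_zero.1 h3).resolve_left (hc n)
    have h3 := hZ.translate_horizontal hC (Γ.mul_mem (hΔΓ _ (hδ n)) hg)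
      (F := F n) (fun h => by simpa [F] using congrFun h 1) h2
    have h4 := hZ.smul (c n) 1 (hc n) one_ne_zero h3
    rw [one_smul, dual_mul, ← mulVec_mulVec, ← map_smul] at h4
    exact h4

end IsInvariantFlagSet


/-! ### Lines all of whose flags belong to the invariant set. -/

namespace IsInvariantFlagSet

variable {Γ : Subgroup SL(3, ℝ)} {Z : (Fin 3 → ℝ) → (Fin 3 → ℝ) → Prop} {Δ : Subgroup SL(2, ℝ)}

/-- All flags with the given line belong to `Z`. -/
def FullLine (Z : (Fin 3 → ℝ) → (Fin 3 → ℝ) → Prop) (x : Fin 3 → ℝ) : Prop :=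
  ∀ f, f ≠ 0 → x ⬝ᵥ f = 0 → Z x f

/-- A functional killing x is approximated by functionals killing `xs n`, by subtracting its
orthogonal projection to `xs n`. -/
theorem fullLine_limit (hZ : IsInvariantFlagSet Γ Z) {x : Fin 3 → ℝ} {xs : ℕ → Fin 3 → ℝ}
    (hx : x ≠ 0) (h : Tendsto xs atTop (𝓝 x)) (hxs : ∀ᶠ n in atTop, FullLine Z (xs n)) :
    FullLine Z x := by
  intro f hf hxf
  have hxx : x ⬝ᵥ x ≠ 0 := dotProduct_self_eq_zero.not.2 hx
  have hc1 : Continuous fun y : Fin 3 → ℝ => y ⬝ᵥ f := continuous_id.dotProduct continuous_const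
  have hc2 : Continuous fun y : Fin 3 → ℝ => y ⬝ᵥ y := continuous_id.dotProduct continuous_id
  have h1 : Tendsto (fun n => xs n ⬝ᵥ f) atTop (𝓝 (x ⬝ᵥ f)) := (hc1.tendsto x).comp h
  have h2 : Tendsto (fun n => xs n ⬝ᵥ xs n) atTop (𝓝 (x ⬝ᵥ x)) := (hc2.tendsto x).comp h
  have h3 : Tendsto (fun n => f - ((xs n ⬝ᵥ f) / (xs n ⬝ᵥ xs n)) • xs n) atTop (𝓝 f) := by
    have := (tendsto_const_nhds (x := f)).sub ((h1.div h2 hxx).smul h)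
    rw [hxf, zero_div, zero_smul, sub_zero] at this
    exact this
  refine hZ.limit hx hf h h3 ?_
  filter_upwards [hxs, h2.eventually_ne hxx, h3.eventually_ne hf] with n hn hne hfn
  refine hn _ hfn ?_
  rw [dotProduct_sub, dotProduct_smul, smul_eq_mul, div_mul_cancel₀ _ hne, sub_self]

theorem fullLine_act (hZ : IsInvariantFlagSet Γ Z) {x : Fin 3 → ℝ} {g : SL(3, ℝ)} (hg : g ∈ Γ)
    (hx : FullLine Z x) : FullLine Z (g.1.mulVec x) := by
  intro f hf hxf
  have h1 : (dual g).mulVec (g.1ᵀ.mulVec f) = f := dual_mulVec_transpose g f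
  have h2 := hZ.act g hg (hx (g.1ᵀ.mulVec f) (fun h => hf (by rw [← h1, h, mulVec_zero])) (by
    rw [dotProduct_mulVec, vecMul_transpose, hxf]))
  rwa [h1] at h2

theorem fullLine_smul (hZ : IsInvariantFlagSet Γ Z) {x : Fin 3 → ℝ} {a : ℝ} (ha : a ≠ 0)
    (hx : FullLine Z x) : FullLine Z (a • x) := by
  intro f hf hxf
  rw [smul_dotProduct, smul_eq_mul] at hxf
  have := hZ.smul a 1 ha one_ne_zero (hx f hf ((mul_eq_zero.1 hxf).resolve_left ha))
  rwa [one_smul] at this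

theorem exists_seq_ne_zero (a : ℝ) : ∃ s : ℕ → ℝ, (∀ n, s n ≠ 0) ∧ Tendsto s atTop (𝓝 a) := by
  obtain ⟨s, hs, hlim⟩ := mem_closure_iff_seq_limit.1 ((dense_compl_singleton (0 : ℝ)) a)
  exact ⟨s, hs, hlim⟩

/-- A closed set of flags, invariant under a Zariski-dense subgroup of `SL(3, ℝ)` that contains a
lattice of the block diagonal `SL(2, ℝ)`, contains all flags as soon as it is nonempty. -/
theorem eq_univ (hZ : IsInvariantFlagSet Γ Z) (hΔ : IsLatticeSL2 Δ)
    (hΔΓ : ∀ δ ∈ Δ, block δ ∈ Γ) (hΓ : IsZariskiDense (Γ : Set SL(3, ℝ)))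
    {x₀ f₀ : Fin 3 → ℝ} (h₀ : Z x₀ f₀) {x f : Fin 3 → ℝ} (hx : x ≠ 0) (hf : f ≠ 0)
    (hxf : x ⬝ᵥ f = 0) : Z x f := by
  have hC : ∀ p q : ℝ, p ≠ 0 ∨ q ≠ 0 → Z ![p, q, 0] ![-q, p, 0] :=
    fun p q => hZ.horizontal hΔ hΔΓ hΓ h₀
  obtain ⟨g, hg, hg0, hg1, hg2⟩ := hΓ.exists_transverse
  have hY1 : FullLine Z ![1, 0, 0] := by
    intro f hf hxf
    have hf0 : f 0 = 0 := by simpa [dotProduct, Fin.sum_univ_three] using hxf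
    -- `base_line` gives only functionals (0, 1, a) with a ≠ 0, so both coordinates of f are
    -- perturbed away from 0.
    obtain ⟨s, hs, hsl⟩ := exists_seq_ne_zero (f 1)
    obtain ⟨t, ht, htl⟩ := exists_seq_ne_zero (f 2)
    have hlim := tendsto_vec3 (tendsto_const_nhds (x := (0 : ℝ))) hsl htl
    have e : ![0, f 1, f 2] = f := by
      ext i
      fin_cases i <;> simp [hf0]
    rw [e] at hlim
    refine hZ.limit (fun h => by simpa using congrFun h 0) hf tendsto_const_nhds hlim
      (Eventually.of_forall fun n => ?_)
    have h1 := hZ.base_line hΔ hΔΓ hC hg hg0 hg1 (div_ne_zero (ht n) (hs n))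
    have h2 := hZ.smul 1 (s n) one_ne_zero (hs n) h1
    have hsn := hs n
    rw [one_smul] at h2
    convert h2 using 1
    ext i
    fin_cases i <;> simp
    field_simp
  -- The limiting projection sends e₁ to α(p, q, 0).
  have hYproj : ∀ {α β p q : ℝ}, α * p + β * q = 1 → α ≠ 0 → FullLine Z ![p, q, 0] := by
    intro α β p q h hα
    obtain ⟨δ, c, hδ, hc, hc0, h00, h01, h10, h11⟩ := hΔ.exists_tendsto_rankOne h
    have hlim := tendsto_vec3 h00 h10 (tendsto_const_nhds (x := (0 : ℝ)))
    have e : ![α * p, α * q, 0] = α • ![p, q, 0] := by simp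
    have hpq : ![p, q, (0 : ℝ)] ≠ 0 := by
      intro h0
      have hp : p = 0 := by simpa using congrFun h0 0
      have hq : q = 0 := by simpa using congrFun h0 1
      simp [hp, hq] at h
    rw [e] at hlim
    have h1 := hZ.fullLine_limit (smul_ne_zero hα hpq) hlim (Eventually.of_forall fun n => by
      have h2 := hZ.fullLine_smul (hc n) (hZ.fullLine_act (hΔΓ _ (hδ n)) hY1)
      rw [smul_block_mulVec] at h2
      simpa using h2)
    have h2 := hZ.fullLine_smul (inv_ne_zero hα) h1
    rwa [inv_smul_smul₀ hα] at h2
  have hYU : ∀ p q : ℝ, p ≠ 0 ∨ q ≠ 0 → FullLine Z ![p, q, 0] := by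
    intro p q hpq
    by_cases hp : p = 0
    · have hq : q ≠ 0 := hpq.resolve_left (not_not.2 hp)
      exact hYproj (α := 1) (β := q⁻¹) (by simp [hp, hq]) one_ne_zero
    · exact hYproj (α := p⁻¹) (β := 0) (by simp [hp]) (inv_ne_zero hp)
  set k := (dual g).mulVec ![0, 0, 1] with hk
  have hYk : ∀ y : Fin 3 → ℝ, y ≠ 0 → k ⬝ᵥ y = 0 → FullLine Z y := by
    intro y hy hky
    rw [hk, dual_mulVec_dotProduct] at hky
    set v := (g⁻¹).1.mulVec y with hv
    have hgv : g.1.mulVec v = y := mulVec_inv_mulVec g y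
    have hv2 : v 2 = 0 := by simpa [dotProduct, Fin.sum_univ_three] using hky
    have e : ![v 0, v 1, 0] = v := by
      ext i
      fin_cases i <;> simp [hv2]
    have h1 := hZ.fullLine_act hg (hYU (v 0) (v 1) (by
      by_contra! h
      apply hy
      rw [← hgv, ← e, h.1, h.2]
      ext i
      fin_cases i <;> simp [mulVec, dotProduct, Fin.sum_univ_three]))
    rwa [e, hgv] at h1
  -- The equation on y says that (y, 1) lies in gU; Δ acts at height one as on ℝ².
  obtain ⟨y, hky, hy⟩ := hΔ.exists_dense_orbit (k := ![k 0, k 1])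
    (fun h => hg1 (by simpa using congrFun h 1)) (neg_ne_zero.2 hg2)
  have hYy : FullLine Z ![y 0, y 1, 1] := by
    refine hYk _ (fun h => by simpa using congrFun h 2) ?_
    simp only [dotProduct, Fin.sum_univ_three, Fin.sum_univ_two] at hky ⊢
    simp at hky ⊢
    linarith
  have hY1 : ∀ z : Fin 2 → ℝ, FullLine Z ![z 0, z 1, 1] := by
    intro z
    obtain ⟨s, hs, hlim⟩ := mem_closure_iff_seq_limit.1 (hy z)
    have h1 := tendsto_vec3 (tendsto_pi_nhds.1 hlim 0) (tendsto_pi_nhds.1 hlim 1)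
      (tendsto_const_nhds (x := (1 : ℝ)))
    refine hZ.fullLine_limit (fun h => by simpa using congrFun h 2) h1
      (Eventually.of_forall fun n => ?_)
    obtain ⟨δ, hδ, hδs⟩ := hs n
    have h2 := hZ.fullLine_act (hΔΓ _ hδ) hYy
    rw [← one_smul ℝ ((block δ).1.mulVec _), smul_block_mulVec] at h2
    rw [← hδs]
    simpa [mulVec, dotProduct, Fin.sum_univ_two] using h2
  obtain ⟨s, hs, hlim⟩ := exists_seq_ne_zero (x 2)
  have h1 := tendsto_vec3 (tendsto_const_nhds (x := x 0)) (tendsto_const_nhds (x := x 1)) hlim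
  have e : ![x 0, x 1, x 2] = x := by
    ext i
    fin_cases i <;> simp
  rw [e] at h1
  refine hZ.fullLine_limit hx h1 (Eventually.of_forall fun n => ?_) f hf hxf
  have h2 := hZ.fullLine_smul (hs n) (hY1 ![x 0 / s n, x 1 / s n])
  have hsn := hs n
  convert h2 using 1
  ext i
  fin_cases i <;> simp <;> field_simp

end IsInvariantFlagSet


/-! ### From flags to pairs (vector, functional), and the quotient topology. -/

namespace Flag3

/-- The functional `y ↦ y ⬝ᵥ f`. -/
def functional (f : Fin 3 → ℝ) : (Fin 3 → ℝ) →ₗ[ℝ] ℝ where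
  toFun y := y ⬝ᵥ f
  map_add' y z := add_dotProduct y z f
  map_smul' c y := smul_dotProduct c y f

/-- The plane orthogonal to `f`. -/
def perp (f : Fin 3 → ℝ) : Submodule ℝ (Fin 3 → ℝ) := LinearMap.ker (functional f)

theorem mem_perp {f y : Fin 3 → ℝ} : y ∈ perp f ↔ y ⬝ᵥ f = 0 := Iff.rfl

theorem finrank_perp {f : Fin 3 → ℝ} (hf : f ≠ 0) : Module.finrank ℝ (perp f) = 2 := by
  have h0 : functional f ≠ 0 := by
    intro h
    apply hf
    rw [← dotProduct_self_eq_zero]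
    exact LinearMap.congr_fun h f
  have h := Module.Dual.finrank_ker_add_one_of_ne_zero (f := functional f) h0
  rw [Module.finrank_fin_fun] at h
  exact Nat.succ_injective h

/-- The flag formed by the line spanned by `x` and the plane orthogonal to `f`. -/
def ofPair (x f : Fin 3 → ℝ) (hx : x ≠ 0) (hf : f ≠ 0) (h : x ⬝ᵥ f = 0) : Flag3 where
  V₁ := Submodule.span ℝ {x}
  V₂ := perp f
  finrank_V₁ := finrank_span_singleton hx
  finrank_V₂ := finrank_perp hf
  le := (Submodule.span_singleton_le_iff_mem _ _).2 h

theorem exists_eq_ofPair (F : Flag3) : ∃ x f hx hf h, F = ofPair x f hx hf h := by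
  obtain ⟨⟨x, hx⟩, hx0, hspan⟩ := finrank_eq_one_iff'.1 F.finrank_V₁
  have hx0' : x ≠ 0 := fun h => hx0 (Subtype.ext h)
  have hV₁ : F.V₁ = Submodule.span ℝ {x} :=
    (Submodule.eq_of_le_of_finrank_eq ((Submodule.span_singleton_le_iff_mem _ _).2 hx)
      (by rw [finrank_span_singleton hx0', F.finrank_V₁])).symm
  let b := Module.finBasisOfFinrankEq ℝ F.V₂ F.finrank_V₂
  have hb : LinearIndependent ℝ ![(b 0 : Fin 3 → ℝ), (b 1 : Fin 3 → ℝ)] := by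
    have := b.linearIndependent.map' F.V₂.subtype F.V₂.ker_subtype
    have e : ![(b 0 : Fin 3 → ℝ), (b 1 : Fin 3 → ℝ)] = F.V₂.subtype ∘ b := by
      ext i
      fin_cases i <;> simp
    rw [e]
    exact this
  set f := crossProduct (b 0 : Fin 3 → ℝ) (b 1 : Fin 3 → ℝ) with hf
  have hf0 : f ≠ 0 := crossProduct_ne_zero_iff_linearIndependent.2 hb
  have hV₂ : F.V₂ = perp f := by
    refine Submodule.eq_of_le_of_finrank_eq (fun y hy => ?_)
      (by rw [finrank_perp hf0, F.finrank_V₂])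
    have h := congrArg Subtype.val (b.sum_repr ⟨y, hy⟩)
    rw [Fin.sum_univ_two] at h
    rw [mem_perp, ← show _ = y from h, Submodule.coe_add, Submodule.coe_smul, Submodule.coe_smul,
      add_dotProduct, smul_dotProduct, smul_dotProduct, hf, dot_self_cross, dot_cross_self]
    simp
  have hxf : x ⬝ᵥ f = 0 := by
    have := F.le hx
    rwa [hV₂] at this
  exact ⟨x, f, hx0', hf0, hxf, Flag3.ext hV₁ hV₂⟩

theorem ofPair_smul {x f : Fin 3 → ℝ} {hx : x ≠ 0} {hf : f ≠ 0} {h : x ⬝ᵥ f = 0} {a b : ℝ}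
    (ha : a ≠ 0) (hb : b ≠ 0) (hx' : a • x ≠ 0) (hf' : b • f ≠ 0) (h' : a • x ⬝ᵥ b • f = 0) :
    ofPair (a • x) (b • f) hx' hf' h' = ofPair x f hx hf h := by
  refine Flag3.ext (Submodule.span_singleton_smul_eq (isUnit_iff_ne_zero.2 ha) x) ?_
  ext y
  change y ⬝ᵥ b • f = 0 ↔ y ⬝ᵥ f = 0
  rw [dotProduct_smul, smul_eq_mul, mul_eq_zero, or_iff_right hb]

theorem mulVec_dotProduct_dual (g : SL(3, ℝ)) (x f : Fin 3 → ℝ) :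
    g.1.mulVec x ⬝ᵥ (dual g).mulVec f = x ⬝ᵥ f := by
  rw [dotProduct_comm, dual_mulVec_dotProduct, inv_mulVec_mulVec, dotProduct_comm]

theorem dual_mulVec_ne_zero (g : SL(3, ℝ)) {f : Fin 3 → ℝ} (hf : f ≠ 0) :
    (dual g).mulVec f ≠ 0 := by
  intro h
  apply hf
  rw [← dotProduct_self_eq_zero, ← mulVec_dotProduct_dual g, h, dotProduct_zero]

theorem smul_ofPair (g : SL(3, ℝ)) {x f : Fin 3 → ℝ} (hx : x ≠ 0) (hf : f ≠ 0)
    (h : x ⬝ᵥ f = 0) :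
    g • ofPair x f hx hf h = ofPair (g.1.mulVec x) ((dual g).mulVec f) (mulVec_ne_zero g hx)
      (dual_mulVec_ne_zero g hf) ((mulVec_dotProduct_dual g x f).trans h) := by
  refine Flag3.ext ?_ ?_
  · change (Submodule.span ℝ {x}).map (Matrix.SpecialLinearGroup.toLin' g).toLinearMap =
      Submodule.span ℝ {g.1.mulVec x}
    rw [Submodule.map_span, image_singleton]
    rfl
  · change (perp f).map (Matrix.SpecialLinearGroup.toLin' g).toLinearMap = _
    ext y
    rw [Submodule.mem_map]
    change _ ↔ y ⬝ᵥ (dual g).mulVec f = 0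
    constructor
    · rintro ⟨z, hz, rfl⟩
      exact (mulVec_dotProduct_dual g z f).trans hz
    · intro hy
      refine ⟨(g⁻¹).1.mulVec y, ?_, mulVec_inv_mulVec g y⟩
      rw [mem_perp, ← mulVec_dotProduct_dual g, mulVec_inv_mulVec, hy]

theorem linearIndependent_of_orthogonal {x f : Fin 3 → ℝ} (hx : x ≠ 0) (hf : f ≠ 0)
    (h : x ⬝ᵥ f = 0) : LinearIndependent ℝ ![x, crossProduct f x] := by
  rw [← crossProduct_ne_zero_iff_linearIndependent, cross_cross_eq_smul_sub_smul',
    dotProduct_comm f x, h, zero_smul,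
    sub_zero]
  exact smul_ne_zero (dotProduct_self_eq_zero.not.2 hx) hf

/-- The vector f × x completes x to a frame of the flag and depends continuously on (x, f), so
limits of pairs become limits of frames. -/
theorem ofFrame_eq_ofPair {x f : Fin 3 → ℝ} (hx : x ≠ 0) (hf : f ≠ 0) (h : x ⬝ᵥ f = 0) :
    ofFrame ⟨![x, crossProduct f x], linearIndependent_of_orthogonal hx hf h⟩ =
      ofPair x f hx hf h := by
  refine Flag3.ext rfl (Submodule.eq_of_le_of_finrank_eq ?_ ?_)
  · refine Submodule.span_le.2 ?_
    rintro _ ⟨i, rfl⟩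
    fin_cases i
    · exact h
    · change crossProduct f x ⬝ᵥ f = 0
      rw [dotProduct_comm, dot_self_cross]
  · rw [Flag3.finrank_V₂, Flag3.finrank_V₂]

instance : ContinuousConstSMul SL(3, ℝ) Flag3 where
  continuous_const_smul g := by
    rw [continuous_coinduced_dom]
    have hinj : Function.Injective (Matrix.SpecialLinearGroup.toLin' g) :=
      (Matrix.SpecialLinearGroup.toLin' g).injective
    let φ : Frame → Frame := fun v => ⟨fun i => g.1.mulVec (v.1 i),
      v.2.map' (Matrix.SpecialLinearGroup.toLin' g).toLinearMap (LinearMap.ker_eq_bot.2 hinj)⟩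
    have hφ : Continuous φ := by
      refine Continuous.subtype_mk (continuous_pi fun i => ?_) _
      exact continuous_const.matrix_mulVec ((continuous_apply i).comp continuous_subtype_val)
    have heq : (fun F : Flag3 => g • F) ∘ ofFrame = ofFrame ∘ φ := by
      funext v
      refine Flag3.ext ?_ ?_
      · change (Submodule.span ℝ {v.1 0}).map (Matrix.SpecialLinearGroup.toLin' g).toLinearMap =
          Submodule.span ℝ {g.1.mulVec (v.1 0)}
        rw [Submodule.map_span, image_singleton]
        rfl
      · change (Submodule.span ℝ (range v.1)).map
          (Matrix.SpecialLinearGroup.toLin' g).toLinearMap =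
          Submodule.span ℝ (range fun i => g.1.mulVec (v.1 i))
        rw [Submodule.map_span, ← range_comp]
        rfl
    rw [heq]
    exact continuous_coinduced_rng.comp hφ

/-- The pairs `(x, f)` representing a flag in `X`. -/
def Represents (X : Set Flag3) (x f : Fin 3 → ℝ) : Prop :=
  ∃ hx hf h, ofPair x f hx hf h ∈ X

theorem isInvariantFlagSet_represents {X : Set Flag3} (hX : IsClosed X) {Γ : Subgroup SL(3, ℝ)}
    (hΓ : ∀ g ∈ Γ, ∀ F ∈ X, g • F ∈ X) : IsInvariantFlagSet Γ (Represents X) where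
  ne_left h := h.1
  ne_right h := h.2.1
  orthogonal h := h.2.2.1
  smul := by
    rintro x f a b ha hb ⟨hx, hf, h, hX⟩
    have h' : a • x ⬝ᵥ b • f = 0 := by
      rw [smul_dotProduct, dotProduct_smul, h, smul_zero, smul_zero]
    refine ⟨smul_ne_zero ha hx, smul_ne_zero hb hf, h', ?_⟩
    rwa [ofPair_smul ha hb]
  act := by
    rintro x f g hg ⟨hx, hf, h, hX⟩
    refine ⟨mulVec_ne_zero g hx, dual_mulVec_ne_zero g hf, (mulVec_dotProduct_dual g x f).trans h,
      ?_⟩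
    rw [← smul_ofPair g hx hf h]
    exact hΓ g hg _ hX
  limit := by
    intro x f xs fs hx hf hxs hfs hev
    have hdot : Continuous fun p : (Fin 3 → ℝ) × (Fin 3 → ℝ) => p.1 ⬝ᵥ p.2 :=
      continuous_fst.dotProduct continuous_snd
    have h : x ⬝ᵥ f = 0 := by
      have h1 := (hdot.tendsto (x, f)).comp (hxs.prodMk_nhds hfs)
      refine tendsto_nhds_unique (h1.congr' ?_) tendsto_const_nhds
      filter_upwards [hev] with n hn
      exact hn.2.2.1
    refine ⟨hx, hf, h, ?_⟩
    -- This closed set of frames is the trace of a closed set C of arbitrary pairs of vectors, where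
    -- the limit can be taken.
    have hcl : IsClosed (ofFrame ⁻¹' X) := hX.preimage continuous_coinduced_rng
    obtain ⟨C, hC, hCX⟩ := isClosed_induced_iff.1 hcl
    have hmem : ∀ v : Frame, v.1 ∈ C ↔ ofFrame v ∈ X := fun v => Set.ext_iff.1 hCX v
    rw [← ofFrame_eq_ofPair hx hf h, ← hmem]
    have hcross : Continuous fun p : (Fin 3 → ℝ) × (Fin 3 → ℝ) =>
        (![p.1, crossProduct p.2 p.1] : Fin 2 → Fin 3 → ℝ) := by
      refine continuous_pi fun i => continuous_pi fun j => ?_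
      fin_cases i <;> fin_cases j <;> simp [cross_apply] <;> fun_prop
    refine hC.mem_of_tendsto ((hcross.tendsto (x, f)).comp (hxs.prodMk_nhds hfs)) ?_
    filter_upwards [hev] with n hn
    obtain ⟨hx', hf', h', hn⟩ := hn
    rw [← ofFrame_eq_ofPair, ← hmem] at hn
    exact hn

/-- A nonempty closed set of flags invariant under a Zariski-dense group that contains a lattice of
the block diagonal `SL(2, ℝ)` is everything. -/
theorem eq_univ_of_invariant {X : Set Flag3} (hX : IsClosed X) (hne : X.Nonempty)
    {Γ : Subgroup SL(3, ℝ)} (hinv : ∀ g ∈ Γ, ∀ F ∈ X, g • F ∈ X)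
    (hΓ : IsZariskiDense (Γ : Set SL(3, ℝ))) {Δ : Subgroup SL(2, ℝ)} (hΔ : IsLatticeSL2 Δ)
    (hΔΓ : ∀ δ ∈ Δ, block δ ∈ Γ) : X = univ := by
  obtain ⟨F₀, hF₀⟩ := hne
  obtain ⟨x₀, f₀, hx₀, hf₀, h₀, rfl⟩ := exists_eq_ofPair F₀
  refine eq_univ_of_forall fun F => ?_
  obtain ⟨x, f, hx, hf, h, rfl⟩ := exists_eq_ofPair F
  obtain ⟨_, _, _, hmem⟩ := (isInvariantFlagSet_represents hX hinv).eq_univ hΔ hΔΓ hΓ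
    ⟨hx₀, hf₀, h₀, hF₀⟩ hx hf h
  exact hmem

end Flag3

/-! ### Reduction to the block diagonal embedding. -/

/-- Zariski density is invariant under conjugation. -/
theorem IsZariskiDense.comap_conj {Γ : Subgroup SL(3, ℝ)}
    (hΓ : IsZariskiDense (Γ : Set SL(3, ℝ))) (T : SL(3, ℝ)) :
    IsZariskiDense (Γ.comap (MulAut.conj T).toMonoidHom : Set SL(3, ℝ)) := by
  intro f hf g
  -- Substituting the entries of P turns f into the polynomial h ↦ f(T⁻¹hT), which vanishes on Γ.
  let P : Matrix (Fin 3) (Fin 3) (MvPolynomial (Fin 3 × Fin 3) ℝ) :=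
    (T⁻¹).1.map MvPolynomial.C * genericMatrix * T.1.map MvPolynomial.C
  have key : ∀ h : SL(3, ℝ), MvPolynomial.eval (fun ij => h.1 ij.1 ij.2)
      (MvPolynomial.bind₁ (fun ij => P ij.1 ij.2) f) =
      MvPolynomial.eval (fun ij => (T⁻¹ * h * T).1 ij.1 ij.2) f := by
    intro h
    have hP : P.map (MvPolynomial.eval fun ij => h.1 ij.1 ij.2) = (T⁻¹ * h * T).1 := by
      rw [Matrix.map_mul, Matrix.map_mul, eval_genericMatrix, SL3.coe_mul', SL3.coe_mul',
        Matrix.map_map, Matrix.map_map]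
      congr 1
      · congr 1
        ext i j
        simp
      · ext i j
        simp
    rw [← hP]
    exact MvPolynomial.eval₂Hom_bind₁ _ _ _ _
  have h1 := hΓ _ (fun γ hγ => (key γ).trans (hf _ (by
    change T * (T⁻¹ * γ * T) * T⁻¹ ∈ Γ
    rwa [show T * (T⁻¹ * γ * T) * T⁻¹ = γ by group]))) (T * g * T⁻¹)
  rw [key] at h1
  convert h1 using 5
  group

/-- The matrix whose columns are `ι e₁`, `ι e₂` and `w`. -/
def adaptedMatrix (ι : (Fin 2 → ℝ) →ₗ[ℝ] (Fin 3 → ℝ)) (w : Fin 3 → ℝ) :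
    Matrix (Fin 3) (Fin 3) ℝ :=
  (Matrix.of ![ι ![1, 0], ι ![0, 1], w])ᵀ

theorem adaptedMatrix_mulVec (ι : (Fin 2 → ℝ) →ₗ[ℝ] (Fin 3 → ℝ)) (w y : Fin 3 → ℝ) :
    (adaptedMatrix ι w).mulVec y = ι ![y 0, y 1] + y 2 • w := by
  have h : (![y 0, y 1] : Fin 2 → ℝ) = y 0 • ![1, 0] + y 1 • ![0, 1] := by simp
  rw [h, map_add, map_smul, map_smul]
  ext i
  simp [adaptedMatrix, mulVec, dotProduct, Fin.sum_univ_three, mul_comm]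

/-- A basis adapted to the splitting can be chosen of determinant one. -/
theorem exists_adapted (ι : (Fin 2 → ℝ) →ₗ[ℝ] (Fin 3 → ℝ)) (hι : Function.Injective ι)
    (W : Submodule ℝ (Fin 3 → ℝ)) (hW : IsCompl (LinearMap.range ι) W) :
    ∃ T : SL(3, ℝ), ∃ w ∈ W, T.1 = adaptedMatrix ι w := by
  have hWne : W ≠ ⊥ := by
    rintro rfl
    have h1 : LinearMap.range ι = ⊤ := by simpa using hW.sup_eq_top
    have h2 := LinearMap.finrank_range_of_inj hι
    rw [h1, finrank_top, Module.finrank_fin_fun, Module.finrank_fin_fun] at h2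
    omega
  obtain ⟨w, hw, hw0⟩ := Submodule.exists_mem_ne_zero_of_ne_bot hWne
  have hdet : (adaptedMatrix ι w).det ≠ 0 := by
    intro h
    obtain ⟨v, hv, hv0⟩ := exists_mulVec_eq_zero_iff.2 h
    rw [adaptedMatrix_mulVec] at hv0
    have h1 : ι ![v 0, v 1] = 0 := by
      refine Submodule.disjoint_def.1 hW.disjoint _ ⟨_, rfl⟩ ?_
      rw [eq_neg_of_add_eq_zero_left hv0]
      exact W.neg_mem (W.smul_mem _ hw)
    rw [h1, zero_add] at hv0
    have h2 : v 2 = 0 := (smul_eq_zero.1 hv0).resolve_right hw0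
    have h3 := (map_eq_zero_iff ι hι).1 h1
    apply hv
    ext i
    fin_cases i
    · simpa using congrFun h3 0
    · simpa using congrFun h3 1
    · simpa using h2
  refine ⟨⟨adaptedMatrix ι ((adaptedMatrix ι w).det⁻¹ • w), ?_⟩, _, W.smul_mem _ hw, rfl⟩
  have h : ∀ c : ℝ, (adaptedMatrix ι (c • w)).det = c * (adaptedMatrix ι w).det := by
    intro c
    simp [adaptedMatrix, det_fin_three]
    ring
  rw [h, inv_mul_cancel₀ hdet]

theorem reducibleEmbedding_mul_adapted (ι : (Fin 2 → ℝ) →ₗ[ℝ] (Fin 3 → ℝ))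
    (hι : Function.Injective ι) (W : Submodule ℝ (Fin 3 → ℝ))
    (hW : IsCompl (LinearMap.range ι) W) {T : SL(3, ℝ)} {w : Fin 3 → ℝ} (hw : w ∈ W)
    (hT : T.1 = adaptedMatrix ι w) (δ : SL(2, ℝ)) :
    reducibleEmbedding ι hι W hW δ * T = T * block δ := by
  apply Subtype.ext
  apply mulVec_injective
  funext y
  have h1 : ∀ x, (reducibleEmbedding ι hι W hW δ).1.mulVec x = splittingMap ι hι W hW δ.1 x :=
    fun x => LinearMap.toMatrix'_mulVec _ x
  rw [SL3.coe_mul', SL3.coe_mul', ← mulVec_mulVec, ← mulVec_mulVec, h1, hT, adaptedMatrix_mulVec,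
    adaptedMatrix_mulVec, map_add, map_smul, splittingMap_range, splittingMap_compl _ _ _ _ _ _ hw,
    ← one_smul ℝ ((block δ).1.mulVec y), smul_block_mulVec]
  congr 2
  · ext i
    fin_cases i <;> simp [mulVec, dotProduct, Fin.sum_univ_two]
  · simp

theorem proposition5p9 (Γ : Subgroup SL(3, ℝ)) (hdiscrete : DiscreteTopology Γ)
    (hdense : IsZariskiDense (Γ : Set SL(3, ℝ)))
    (ι : (Fin 2 → ℝ) →ₗ[ℝ] (Fin 3 → ℝ)) (hι : Function.Injective ι)
    (W : Submodule ℝ (Fin 3 → ℝ)) (hW : IsCompl (LinearMap.range ι) W)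
    (hlattice : IsLatticeSL2 (Γ.comap (reducibleEmbedding ι hι W hW))) :
    MulAction.IsMinimal Γ Flag3 := by
  refine ⟨fun F => ?_⟩
  obtain ⟨T, w, hw, hT⟩ := exists_adapted ι hι W hW
  have hinv : ∀ γ ∈ Γ, ∀ E ∈ closure (MulAction.orbit Γ F),
      γ • E ∈ closure (MulAction.orbit Γ F) := by
    intro γ hγ E hE
    refine map_mem_closure (continuous_const_smul γ) hE ?_
    rintro _ ⟨γ', rfl⟩
    refine ⟨⟨γ, hγ⟩ * γ', ?_⟩
    change (γ * (γ' : SL(3, ℝ))) • F = γ • (γ' : SL(3, ℝ)) • F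
    rw [mul_smul]
  -- The orbit closure pulled back by T is invariant under T⁻¹ΓT, which contains `block δ` exactly
  -- when Γ contains the image of δ.
  have huniv : (fun E : Flag3 => T • E) ⁻¹' closure (MulAction.orbit Γ F) = univ := by
    refine Flag3.eq_univ_of_invariant (isClosed_closure.preimage (continuous_const_smul T))
      ⟨T⁻¹ • F, ?_⟩ (Γ := Γ.comap (MulAut.conj T).toMonoidHom) ?_ (hdense.comap_conj T) hlattice ?_
    · rw [mem_preimage, smul_inv_smul]
      exact subset_closure (MulAction.mem_orbit_self F)
    · intro g hg E hE
      have h1 := hinv (T * g * T⁻¹) hg _ hE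
      rw [mem_preimage]
      rwa [mul_smul, mul_smul, inv_smul_smul] at h1
    · intro δ hδ
      change T * block δ * T⁻¹ ∈ Γ
      rw [← reducibleEmbedding_mul_adapted ι hι W hW hw hT, mul_inv_cancel_right]
      exact hδ
  rw [dense_iff_closure_eq]
  refine eq_univ_of_forall fun E => ?_
  have h1 : T⁻¹ • E ∈ (fun E : Flag3 => T • E) ⁻¹' closure (MulAction.orbit Γ F) := by
    rw [huniv]
    trivial
  rwa [mem_preimage, smul_inv_smul] at h1
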